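/- Let $R\ge 0$ be a random variable with $\mathbb{E}R^2=1$ and $\mathbb{E}R^4<\infty$. For every $d\in\mathbb{N}=\{1,2,\dots\}$ let $R_1,R_2,\dots$ be independent copies of $R$, let $U_1^{(d)},U_2^{(d)},\dots$ be i.i.d. random vectors uniformly distributed on the unit sphere of $\mathbb{R}^d$, and let the sequences $(R_i)_{i\ge1}$ and $(U_i^{(d)})_{i\ge1}$ be independent of each other. Put $$S_k^{(d)}:=\sum_{i=1}^k R_iU_i^{(d)},\qquad k\in\mathbb{N},$$ and let $\|\cdot\|$ be the Euclidean norm. Let $n=n(d)$ be a sequence of positive integers with $n(d)\to\infty$ as $d\to\infty$. Call $R$ deterministic if it is almost surely equal to a constant, and write $\mathrm{N}(0,\sigma^2)$ for the centered normal distribution with variance $\sigma^2$. Then, as $d\to\infty$, the following convergences in distribution hold. (a) If $\lim_{d\to\infty} n/d=0$ and $R$ is not deterministic, then $$\frac{\|S_n^{(d)}\|^2-n}{\sqrt n}\longrightarrow \mathrm{N}(0,\operatorname{Var}(R^2)).$$ (b) If $\lim_{d\to\infty} n/d=\infty$ or $R$ is deterministic, then $$\frac{\|S_n^{(d)}\|^2-n}{\sqrt{2n^2/d}}\longrightarrow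 \mathrm{N}(0,1).$$ (c) If $n\sim\gamma d$ as $d\to\infty$ for some constant $\gamma\in(0,\infty)$, then $$\frac{\|S_n^{(d)}\|^2-n}{\sqrt n}\longrightarrow \mathrm{N}(0,2\gamma+\operatorname{Var}(R^2)).$$ -/

import Mathlib

open MeasureTheory ProbabilityTheory Filter Topology Asymptotics
open scoped ENNReal NNReal

noncomputable section

/-- The uniform distribution on the unit sphere of `ℝ^d` (with its Euclidean norm), as a measure
on `ℝ^d`: the normalized surface measure, pushed forward by the inclusion of the sphere.
For `d = 1` it is the uniform distribution on `{-1, 1}`. -/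
def uniformUnitSphere (d : ℕ) : Measure (EuclideanSpace ℝ (Fin d)) :=
  Measure.map Subtype.val
    (ProbabilityTheory.cond
      (volume : Measure (EuclideanSpace ℝ (Fin d))).toSphere Set.univ)

/-- On the probability space `(Ω, P)`, the variables `R 0, R 1, …` are independent copies of the
random variable `R₀` (which may live on another probability space), `U 0, U 1, …` are i.i.d.
uniformly distributed on the unit sphere of `ℝ^d`, and the two sequences are independent. -/
structure IsRadialDirectional {Ω₀ Ω : Type*} [MeasurableSpace Ω₀] [MeasurableSpace Ω]
    (P₀ : Measure Ω₀) (P : Measure Ω) (d : ℕ) (R₀ : Ω₀ → ℝ)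
    (R : ℕ → Ω → ℝ) (U : ℕ → Ω → EuclideanSpace ℝ (Fin d)) : Prop where
  radial_copy : ∀ i, IdentDistrib (R i) R₀ P P₀
  radial_indep : iIndepFun R P
  direction_law : ∀ i, HasLaw (U i) (uniformUnitSphere d) P
  direction_indep : iIndepFun U P
  radial_indep_direction : IndepFun (fun ω i ↦ R i ω) (fun ω i ↦ U i ω) P

/-- The random walk `S_k = R_1 U_1 + ⋯ + R_k U_k` (the increments are numbered from `0`). -/
def radialWalk {Ω : Type*} {d : ℕ} (R : ℕ → Ω → ℝ) (U : ℕ → Ω → EuclideanSpace ℝ (Fin d))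
    (k : ℕ) (ω : Ω) : EuclideanSpace ℝ (Fin d) :=
  ∑ i ∈ Finset.range k, R i ω • U i ω

/-- A real random variable is called deterministic if it is almost surely equal to a constant. -/
def IsAlmostSurelyConst {Ω : Type*} [MeasurableSpace Ω] (X : Ω → ℝ) (P : Measure Ω) : Prop :=
  ∃ c : ℝ, ∀ᵐ ω ∂P, X ω = c

end

/-!
The direction of a standard Gaussian vector is uniform and independent of its norm. So the walk with
increments `R i • g i / √d`, with `g i` standard Gaussian in `ℝ^d`, is `∑ i, R i • U i` with each
`R i` multiplied by an independent factor `‖g i‖ / √d`, close to `1`. The inner products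
`⟪U i, U j⟫`, `i < j`, are orthogonal in `L²` with second moment `1 / d`, so replacing the factors
by `1` changes the squared norm of the walk by `O(n / d + n² / d²)` in mean square.

Given the radii, the Gaussian walk is a centred Gaussian vector with covariance `(Q / d) I`, where
`Q = ∑ i, R i ^ 2`. Hence its squared norm is distributed as `Q ‖g‖² / d` with `g` standard Gaussian
and independent of `Q`, and
`Q ‖g‖² / d - n = (Q - n) + (n / d) (‖g‖² - d) + (Q - n) (‖g‖² / d - 1)`.
The last product is negligible in mean square. The first two terms are independent, `Q - n` is a sum
of `n` copies of `R² - 1` and `‖g‖² - d` one of `d` copies of `x² - 1` with `x` standard normal, so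
the central limit theorem applies to both, with total variance `n Var(R²) + 2 n² / d`; the three
regimes differ in which of the two summands survives the normalization.
-/

section CharFun

lemma norm_exp_ofReal_mul_I_sub_exp_ofReal_mul_I_le (x y : ℝ) :
    ‖Complex.exp (x * Complex.I) - Complex.exp (y * Complex.I)‖ ≤ |x - y| := by
  have hfactor : Complex.exp (x * Complex.I) - Complex.exp (y * Complex.I) =
      Complex.exp (y * Complex.I) * (Complex.exp (Complex.I * (x - y : ℝ)) - 1) := by
    rw [mul_sub, ← Complex.exp_add]
    push_cast
    ring_nf
  rw [hfactor, norm_mul, Complex.norm_exp_ofReal_mul_I, one_mul]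
  exact Real.norm_exp_I_mul_ofReal_sub_one_le

lemma integrable_exp_ofReal_mul_I {Ω : Type*} [MeasurableSpace Ω] {P : Measure Ω}
    [IsFiniteMeasure P] {X : Ω → ℝ} (hX : AEMeasurable X P) :
    Integrable (fun ω ↦ Complex.exp (X ω * Complex.I)) P :=
  .of_bound (C := 1) (AEMeasurable.aestronglyMeasurable (by fun_prop))
    (.of_forall fun ω ↦ (Complex.norm_exp_ofReal_mul_I _).le)

lemma integral_abs_le_sqrt_integral_sq {Ω : Type*} [MeasurableSpace Ω] {P : Measure Ω}
    [IsProbabilityMeasure P] {X : Ω → ℝ} (hX : MemLp X 2 P) :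
    ∫ ω, |X ω| ∂P ≤ √(∫ ω, X ω ^ 2 ∂P) := by
  refine Real.le_sqrt_of_sq_le ?_
  simpa [variance_eq_sub hX.abs] using variance_nonneg |X| P

lemma norm_charFun_map_sub_charFun_map_le {Ω : Type*} [MeasurableSpace Ω] {P : Measure Ω}
    [IsProbabilityMeasure P] {X Y : Ω → ℝ} (hX : AEMeasurable X P) (hY : AEMeasurable Y P)
    (hXY : MemLp (fun ω ↦ X ω - Y ω) 2 P) (t : ℝ) :
    ‖charFun (P.map X) t - charFun (P.map Y) t‖ ≤ |t| * √(∫ ω, (X ω - Y ω) ^ 2 ∂P) := by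
  have hint {Z : Ω → ℝ} (hZ : AEMeasurable Z P) :
      Integrable (fun ω ↦ Complex.exp (t * Z ω * Complex.I)) P := by
    exact_mod_cast integrable_exp_ofReal_mul_I (hZ.const_mul t)
  rw [charFun_apply_real, charFun_apply_real, integral_map hX (by fun_prop),
    integral_map hY (by fun_prop), ← integral_sub (hint hX) (hint hY)]
  calc _ ≤ ∫ ω, |t| * |X ω - Y ω| ∂P := by
        refine norm_integral_le_of_norm_le ((hXY.integrable one_le_two).abs.const_mul |t|)
          (.of_forall fun ω ↦ ?_)
        rw [← abs_mul, mul_sub]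
        exact_mod_cast norm_exp_ofReal_mul_I_sub_exp_ofReal_mul_I_le (t * X ω) (t * Y ω)
    _ ≤ |t| * √(∫ ω, (X ω - Y ω) ^ 2 ∂P) := by
        rw [integral_const_mul]
        gcongr
        exact integral_abs_le_sqrt_integral_sq hXY

lemma charFun_map_sub_const {Ω : Type*} [MeasurableSpace Ω] {P : Measure Ω} {X : Ω → ℝ}
    (hX : AEMeasurable X P) (c t : ℝ) :
    charFun (P.map fun ω ↦ X ω - c) t =
      charFun (P.map X) t * Complex.exp ((-c * t : ℝ) * Complex.I) := by
  have hmap : P.map (fun ω ↦ X ω - c) = (P.map X).map (· + -c) := by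
    rw [AEMeasurable.map_map_of_aemeasurable (by fun_prop) hX]
    rfl
  simp [hmap, charFun_map_add_const, mul_comm t]

lemma norm_charFun_map_sub_const_sub {Ω Ω' : Type*} [MeasurableSpace Ω] [MeasurableSpace Ω']
    {P : Measure Ω} {P' : Measure Ω'} {X : Ω → ℝ} {Y : Ω' → ℝ} (hX : AEMeasurable X P)
    (hY : AEMeasurable Y P') (c t : ℝ) :
    ‖charFun (P.map fun ω ↦ X ω - c) t - charFun (P'.map fun ω ↦ Y ω - c) t‖ =
      ‖charFun (P.map X) t - charFun (P'.map Y) t‖ := by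
  rw [charFun_map_sub_const hX, charFun_map_sub_const hY, ← sub_mul, norm_mul,
    Complex.norm_exp_ofReal_mul_I, mul_one]

lemma norm_mul_sub_mul_le {A : Type*} [SeminormedRing A] {a b a' b' : A} (ha : ‖a‖ ≤ 1)
    (hb' : ‖b'‖ ≤ 1) : ‖a * b - a' * b'‖ ≤ ‖a - a'‖ + ‖b - b'‖ := by
  calc ‖a * b - a' * b'‖ = ‖(a - a') * b' + a * (b - b')‖ := by congr 1; noncomm_ring
    _ ≤ ‖a - a'‖ * ‖b'‖ + ‖a‖ * ‖b - b'‖ :=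
        (norm_add_le _ _).trans (add_le_add (norm_mul_le _ _) (norm_mul_le _ _))
    _ ≤ ‖a - a'‖ + ‖b - b'‖ :=
        add_le_add (mul_le_of_le_one_right (norm_nonneg _) hb')
          (mul_le_of_le_one_left (norm_nonneg _) ha)

lemma norm_pow_sub_pow_le {A : Type*} [SeminormedRing A] [NormOneClass A] {a b : A}
    (ha : ‖a‖ ≤ 1) (hb : ‖b‖ ≤ 1) (n : ℕ) : ‖a ^ n - b ^ n‖ ≤ n * ‖a - b‖ := by
  induction n with
  | zero => simp
  | succ n ih =>
    have hpow : ‖a ^ n‖ ≤ 1 := (norm_pow_le a n).trans (pow_le_one₀ (norm_nonneg a) ha)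
    rw [pow_succ, pow_succ, Nat.cast_succ, add_one_mul]
    exact (norm_mul_sub_mul_le hpow hb).trans (by gcongr)

lemma charFun_sub_charFun_isLittleO_sq {μ ν : Measure ℝ} [IsProbabilityMeasure μ]
    [IsProbabilityMeasure ν] (hμ : MemLp id 2 μ) (hν : MemLp id 2 ν)
    (hmean : ∫ x, x ∂μ = ∫ x, x ∂ν) (hsq : ∫ x, x ^ 2 ∂μ = ∫ x, x ^ 2 ∂ν) :
    (fun s ↦ charFun μ s - charFun ν s) =o[𝓝 0] fun s : ℝ ↦ s ^ 2 := by
  have htaylor {ρ : Measure ℝ} [IsProbabilityMeasure ρ] (hρ : MemLp id 2 ρ) :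
      (fun s ↦ charFun ρ s - taylorWithinEval (charFun ρ) 2 Set.univ 0 s) =o[𝓝 0]
        fun s : ℝ ↦ s ^ 2 := by
    simpa using taylor_isLittleO_univ (n := 2) (x₀ := 0) (contDiff_charFun hρ)
  have hpoly (s : ℝ) : taylorWithinEval (charFun μ) 2 Set.univ 0 s =
      taylorWithinEval (charFun ν) 2 Set.univ 0 s := by
    rw [taylorWithinEval_charFun_zero hμ, taylorWithinEval_charFun_zero hν]
    simp [Finset.sum_range_succ, hmean, hsq]
  refine ((htaylor hμ).sub (htaylor hν)).congr_left fun s ↦ ?_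
  rw [hpoly, sub_sub_sub_cancel_right]

variable {ι : Type*} {l : Filter ι} {n : ι → ℕ} {s : ι → ℝ}

lemma tendsto_charFun_pow_sub_charFun_pow {μ ν : Measure ℝ} [IsProbabilityMeasure μ]
    [IsProbabilityMeasure ν] (hμ : MemLp id 2 μ) (hν : MemLp id 2 ν)
    (hmean : ∫ x, x ∂μ = ∫ x, x ∂ν) (hsq : ∫ x, x ^ 2 ∂μ = ∫ x, x ^ 2 ∂ν)
    (hs : Tendsto s l (𝓝 0)) (hns : (fun i ↦ n i * s i ^ 2) =O[l] fun _ ↦ (1 : ℝ)) :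
    Tendsto (fun i ↦ charFun μ (s i) ^ n i - charFun ν (s i) ^ n i) l (𝓝 0) := by
  have hbound : (fun i ↦ charFun μ (s i) ^ n i - charFun ν (s i) ^ n i) =O[l]
      fun i ↦ (n i : ℝ) * ‖charFun μ (s i) - charFun ν (s i)‖ := by
    refine .of_bound 1 (.of_forall fun i ↦ ?_)
    rw [one_mul, norm_mul, norm_norm, Real.norm_natCast]
    exact norm_pow_sub_pow_le (norm_charFun_le_one _) (norm_charFun_le_one _) _
  have hsmall := (isBigO_refl (fun i ↦ (n i : ℝ)) l).mul_isLittleO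
    ((charFun_sub_charFun_isLittleO_sq hμ hν hmean hsq).comp_tendsto hs).norm_left
  exact (isLittleO_one_iff ℝ).1 ((hbound.trans_isLittleO hsmall).trans_isBigO hns)

lemma tendsto_charFun_pow_sub_exp {μ : Measure ℝ} [IsProbabilityMeasure μ] (hμ : MemLp id 2 μ)
    (hmean : ∫ x, x ∂μ = 0) (hn : Tendsto n l atTop)
    (hns : (fun i ↦ n i * Var[id; μ] * s i ^ 2) =O[l] fun _ ↦ (1 : ℝ)) :
    Tendsto (fun i ↦ charFun μ (s i) ^ n i -
      Complex.exp (-(n i * Var[id; μ] * s i ^ 2) / 2 : ℝ)) l (𝓝 0) := by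
  obtain hV | hV := eq_or_ne Var[id; μ] 0
  · have hdirac : μ = Measure.dirac 0 := by
      have hconst : ∀ᵐ x ∂μ, id x = 0 := by
        simpa [hmean] using ae_eq_integral_of_variance_eq_zero hμ hV
      simpa using Measure.map_congr hconst
    simpa [hV] using tendsto_const_nhds.congr fun i ↦ (by simp [hdirac, charFun_dirac])
  let ν : Measure ℝ := gaussianReal 0 Var[id; μ].toNNReal
  have hns' : (fun i ↦ n i * s i ^ 2) =O[l] fun _ ↦ (1 : ℝ) := by
    refine (hns.const_mul_left Var[id; μ]⁻¹).congr_left fun i ↦ ?_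
    field_simp
  have hs : Tendsto s l (𝓝 0) := by
    have hn' : Tendsto (fun i ↦ (n i : ℝ)⁻¹) l (𝓝 0) :=
      tendsto_inv_atTop_zero.comp (tendsto_natCast_atTop_atTop.comp hn)
    have hsq : Tendsto (fun i ↦ s i ^ 2) l (𝓝 0) := by
      refine ((hns'.mul (isBigO_refl _ l)).trans_tendsto (by simpa using hn')).congr' ?_
      filter_upwards [hn.eventually_ne_atTop 0] with i hi
      field_simp
    simpa [Real.sqrt_sq_eq_abs, tendsto_zero_iff_abs_tendsto_zero s, Function.comp_def] using
      hsq.sqrt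
  have hsecond {ρ : Measure ℝ} (hρ : ∫ x, x ∂ρ = 0) : ∫ x, x ^ 2 ∂ρ = Var[id; ρ] :=
    (variance_of_integral_eq_zero aemeasurable_id hρ).symm
  have hνmean : ∫ x, x ∂ν = 0 := integral_id_gaussianReal
  have hpow := tendsto_charFun_pow_sub_charFun_pow hμ (memLp_id_gaussianReal 2)
    (hmean.trans hνmean.symm) (by rw [hsecond hmean, hsecond hνmean, variance_id_gaussianReal,
      Real.coe_toNNReal _ (variance_nonneg _ _)]) hs hns'
  refine hpow.congr fun i ↦ ?_
  rw [charFun_gaussianReal, ← Complex.exp_nat_mul, Real.coe_toNNReal _ (variance_nonneg _ _)]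
  push_cast
  ring_nf

lemma tendsto_charFun_pow_mul_charFun_pow {m : ι → ℕ} {u : ι → ℝ} {μ ν : Measure ℝ}
    [IsProbabilityMeasure μ] [IsProbabilityMeasure ν] (hμ : MemLp id 2 μ) (hν : MemLp id 2 ν)
    (hμ_mean : ∫ x, x ∂μ = 0) (hν_mean : ∫ x, x ∂ν = 0) (hn : Tendsto n l atTop)
    (hm : Tendsto m l atTop) {v : ℝ}
    (hv : Tendsto (fun i ↦ n i * Var[id; μ] * s i ^ 2 + m i * Var[id; ν] * u i ^ 2) l (𝓝 v)) :
    Tendsto (fun i ↦ charFun μ (s i) ^ n i * charFun ν (u i) ^ m i) l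
      (𝓝 (Complex.exp (-v / 2 : ℝ))) := by
  have hnonneg (ρ : Measure ℝ) (k : ℕ) (r : ℝ) : 0 ≤ k * Var[id; ρ] * r ^ 2 :=
    mul_nonneg (mul_nonneg k.cast_nonneg (variance_nonneg _ _)) (sq_nonneg r)
  have hbound {f : ι → ℝ} (hf : ∀ i, 0 ≤ f i)
      (hfv : ∀ i, f i ≤ n i * Var[id; μ] * s i ^ 2 + m i * Var[id; ν] * u i ^ 2) :
      f =O[l] fun _ ↦ (1 : ℝ) := by
    refine (IsBigO.of_norm_le fun i ↦ ?_).trans (hv.isBigO_one ℝ)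
    rw [Real.norm_of_nonneg (hf i)]
    exact hfv i
  have hμ_lim := tendsto_charFun_pow_sub_exp (s := s) hμ hμ_mean hn
    (hbound (fun i ↦ hnonneg μ _ _) fun i ↦ le_add_of_nonneg_right (hnonneg ν _ _))
  have hν_lim := tendsto_charFun_pow_sub_exp (s := u) hν hν_mean hm
    (hbound (fun i ↦ hnonneg ν _ _) fun i ↦ le_add_of_nonneg_left (hnonneg μ _ _))
  have hpow_le (ρ : Measure ℝ) [IsProbabilityMeasure ρ] (k : ℕ) (r : ℝ) :
      ‖charFun ρ r ^ k‖ ≤ 1 := by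
    rw [norm_pow]
    exact pow_le_one₀ (norm_nonneg _) (norm_charFun_le_one r)
  have hexp_le (k : ℕ) (r : ℝ) : ‖Complex.exp (-(k * Var[id; ν] * r ^ 2) / 2 : ℝ)‖ ≤ 1 := by
    rw [Complex.norm_exp_ofReal, Real.exp_le_one_iff]
    linarith [hnonneg ν k r]
  have hdiff : Tendsto (fun i ↦ charFun μ (s i) ^ n i * charFun ν (u i) ^ m i -
      Complex.exp (-(n i * Var[id; μ] * s i ^ 2) / 2 : ℝ) *
        Complex.exp (-(m i * Var[id; ν] * u i ^ 2) / 2 : ℝ)) l (𝓝 0) :=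
    squeeze_zero_norm (fun i ↦ norm_mul_sub_mul_le (hpow_le μ _ _) (hexp_le _ _))
      (by simpa using hμ_lim.norm.add hν_lim.norm)
  have hexp : Tendsto (fun i ↦ Complex.exp
      (-(n i * Var[id; μ] * s i ^ 2 + m i * Var[id; ν] * u i ^ 2) / 2 : ℝ)) l
      (𝓝 (Complex.exp (-v / 2 : ℝ))) :=
    ((Complex.continuous_exp.comp Complex.continuous_ofReal).tendsto _).comp (hv.neg.div_const 2)
  rw [← zero_add (Complex.exp _)]
  refine (hdiff.add hexp).congr fun i ↦ ?_
  rw [neg_add, add_div, Complex.ofReal_add, Complex.exp_add, sub_add_cancel]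

lemma tendstoInDistribution_of_tendsto_charFun [l.IsCountablyGenerated] {Ω : ι → Type*}
    [∀ i, MeasurableSpace (Ω i)] {P : (i : ι) → Measure (Ω i)} [∀ i, IsProbabilityMeasure (P i)]
    {X : (i : ι) → Ω i → ℝ} (hX : ∀ i, AEMeasurable (X i) (P i)) {ν : Measure ℝ}
    [IsProbabilityMeasure ν]
    (h : ∀ t, Tendsto (fun i ↦ charFun ((P i).map (X i)) t) l (𝓝 (charFun ν t))) :
    TendstoInDistribution X l id P ν where
  forall_aemeasurable := hX
  tendsto := by
    refine tendsto_of_seq_tendsto fun u hu ↦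
      ProbabilityMeasure.tendsto_of_tendsto_charFun fun t ↦ ?_
    simpa [Measure.map_id] using! (h t).comp hu

end CharFun

section ProductMeasure

section Prod

variable {X Y Z : Type*} [MeasurableSpace X] [MeasurableSpace Y] [MeasurableSpace Z]
  {μ : Measure X} {ν : Measure Y} {ρ : Measure Z} [IsProbabilityMeasure μ]
  [IsProbabilityMeasure ν] [IsProbabilityMeasure ρ] {f : X × Y → ℝ} {g : X × Z → ℝ}

omit [IsProbabilityMeasure ν] in
lemma charFun_map_prodMk_left (hf : Measurable f) (t : ℝ) (x : X) :
    charFun (ν.map fun y ↦ f (x, y)) t = ∫ y, Complex.exp (t * f (x, y) * Complex.I) ∂ν := by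
  rw [charFun_apply_real, integral_map (by fun_prop) (by fun_prop)]

lemma integrable_charFun_map_prodMk_left (hf : Measurable f) (t : ℝ) :
    Integrable (fun x ↦ charFun (ν.map fun y ↦ f (x, y)) t) μ := by
  have hint := integrable_exp_ofReal_mul_I (P := μ.prod ν) (hf.const_mul t).aemeasurable
  simpa only [charFun_map_prodMk_left hf, Complex.ofReal_mul] using hint.integral_prod_left

lemma charFun_map_prod_eq_integral (hf : Measurable f) (t : ℝ) :
    charFun ((μ.prod ν).map f) t = ∫ x, charFun (ν.map fun y ↦ f (x, y)) t ∂μ := by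
  have hint := integrable_exp_ofReal_mul_I (P := μ.prod ν) (hf.const_mul t).aemeasurable
  simp only [Complex.ofReal_mul] at hint
  rw [charFun_apply_real, integral_map (by fun_prop) (by fun_prop), integral_prod _ hint]
  simp only [charFun_map_prodMk_left hf]

lemma norm_charFun_map_prod_sub_le (hf : Measurable f) (hg : Measurable g) {B : X → ℝ}
    (hB : Integrable B μ) (t : ℝ)
    (h : ∀ x, ‖charFun (ν.map fun y ↦ f (x, y)) t - charFun (ρ.map fun z ↦ g (x, z)) t‖ ≤ B x) :
    ‖charFun ((μ.prod ν).map f) t - charFun ((μ.prod ρ).map g) t‖ ≤ ∫ x, B x ∂μ := by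
  rw [charFun_map_prod_eq_integral hf, charFun_map_prod_eq_integral hg,
    ← integral_sub (integrable_charFun_map_prodMk_left hf t)
      (integrable_charFun_map_prodMk_left hg t)]
  exact norm_integral_le_of_norm_le hB (.of_forall h)

lemma charFun_map_add_prod {f : X → ℝ} {g : Y → ℝ} (hf : Measurable f) (hg : Measurable g) (t : ℝ) :
    charFun ((μ.prod ν).map fun z ↦ f z.1 + g z.2) t =
      charFun (μ.map f) t * charFun (ν.map g) t := by
  have := Measure.isProbabilityMeasure_map (μ := μ) hf.aemeasurable
  have := Measure.isProbabilityMeasure_map (μ := ν) hg.aemeasurable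
  rw [← Pi.mul_apply, ← charFun_map_add_prod_eq_mul, Measure.map_prod_map μ ν hf hg,
    Measure.map_map (by fun_prop) (by fun_prop)]
  rfl

omit [IsProbabilityMeasure μ] [IsProbabilityMeasure ν] in
lemma memLp_mul_prod [SFinite μ] [SFinite ν] {f : X → ℝ} {g : Y → ℝ} (hf : MemLp f 2 μ)
    (hg : MemLp g 2 ν) : MemLp (fun z : X × Y ↦ f z.1 * g z.2) 2 (μ.prod ν) := by
  refine (memLp_two_iff_integrable_sq (hf.1.comp_fst.mul hg.1.comp_snd)).2 ?_
  simpa only [Pi.mul_apply, mul_pow] using hf.integrable_sq.mul_prod hg.integrable_sq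

end Prod

variable {ι : Type*} [Fintype ι]

lemma charFun_map_sum_comp_eval_pi {X E : Type*} [MeasurableSpace X] [NormedAddCommGroup E]
    [InnerProductSpace ℝ E] [MeasurableSpace E] [BorelSpace E] [SecondCountableTopology E]
    {μ : Measure X} [IsProbabilityMeasure μ] {f : ι → X → E} (hf : ∀ i, Measurable (f i)) (t : E) :
    charFun ((Measure.pi fun _ ↦ μ).map fun x ↦ ∑ i, f i (x i)) t =
      ∏ i, charFun (μ.map (f i)) t := by
  have hindep : iIndepFun (fun i (x : ι → X) ↦ f i (x i)) (Measure.pi fun _ ↦ μ) :=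
    iIndepFun_pi fun i ↦ (hf i).aemeasurable
  have heval (i : ι) : (Measure.pi fun _ ↦ μ).map (fun x : ι → X ↦ f i (x i)) = μ.map (f i) := by
    conv_rhs => rw [← (measurePreserving_eval (fun _ : ι ↦ μ) i).map_eq,
      Measure.map_map (hf i) (measurable_pi_apply i)]
    rfl
  have haem (i : ι) : AEMeasurable (fun x : ι → X ↦ f i (x i)) (Measure.pi fun _ ↦ μ) :=
    ((hf i).comp (measurable_pi_apply i)).aemeasurable
  rw [hindep.charFun_map_fun_sum_eq_prod haem, Finset.prod_apply]
  simp_rw [heval]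

lemma integral_sum_comp_eval_pi {X : Type*} [MeasurableSpace X] {μ : Measure X}
    [IsProbabilityMeasure μ] {f : ι → X → ℝ} (hf : ∀ i, Integrable (f i) μ) :
    ∫ x, ∑ i, f i (x i) ∂(Measure.pi fun _ ↦ μ) = ∑ i, ∫ x, f i x ∂μ := by
  have heval (i : ι) := measurePreserving_eval (fun _ : ι ↦ μ) i
  have hint (i : ι) : Integrable (fun x : ι → X ↦ f i (x i)) (Measure.pi fun _ ↦ μ) :=
    (heval i).integrable_comp_of_integrable (hf i)
  rw [integral_finsetSum _ fun i _ ↦ hint i]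
  exact Finset.sum_congr rfl fun i _ ↦ (heval i).hasLaw.integral_comp (hf i).aestronglyMeasurable

lemma integral_sq_sum_comp_eval_pi {X : Type*} [MeasurableSpace X] {μ : Measure X}
    [IsProbabilityMeasure μ] {f : ι → X → ℝ} (hf : ∀ i, MemLp (f i) 2 μ)
    (hmean : ∀ i, ∫ x, f i x ∂μ = 0) :
    ∫ x, (∑ i, f i (x i)) ^ 2 ∂(Measure.pi fun _ ↦ μ) = ∑ i, ∫ x, f i x ^ 2 ∂μ := by
  have hsum : MemLp (fun x : ι → X ↦ ∑ i, f i (x i)) 2 (Measure.pi fun _ ↦ μ) :=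
    memLp_finsetSum _ fun i _ ↦ (hf i).comp_measurePreserving (measurePreserving_eval _ i)
  have hmean_sum : ∫ x, ∑ i, f i (x i) ∂(Measure.pi fun _ ↦ μ) = 0 := by
    rw [integral_sum_comp_eval_pi fun i ↦ (hf i).integrable one_le_two]
    exact Finset.sum_eq_zero fun i _ ↦ hmean i
  rw [← variance_of_integral_eq_zero hsum.aemeasurable hmean_sum]
  simpa [variance_of_integral_eq_zero (hf _).aemeasurable (hmean _), Finset.sum_fn] using
    variance_sum_pi hf

lemma measurePreserving_eval_pair_pi {X : Type*} [MeasurableSpace X] (μ : Measure X)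
    [IsProbabilityMeasure μ] {i j : ι} (hij : i ≠ j) :
    MeasurePreserving (fun x : ι → X ↦ (x i, x j)) (Measure.pi fun _ ↦ μ) (μ.prod μ) := by
  have hindep : IndepFun (fun x : ι → X ↦ x i) (fun x ↦ x j) (Measure.pi fun _ ↦ μ) :=
    (iIndepFun_pi (X := fun _ : ι ↦ (id : X → X)) fun _ ↦ aemeasurable_id).indepFun hij
  exact ((indepFun_iff_hasLaw_prodMk_prod (measurePreserving_eval (fun _ ↦ μ) i).hasLaw
    (measurePreserving_eval (fun _ ↦ μ) j).hasLaw).1 hindep).measurePreserving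
      ((measurable_pi_apply i).prodMk (measurable_pi_apply j))

lemma integral_sq_sum_of_orthogonal {Ω κ : Type*} [MeasurableSpace Ω] {P : Measure Ω}
    {s : Finset κ} {f : κ → Ω → ℝ} (hf : ∀ k ∈ s, MemLp (f k) 2 P)
    (horth : ∀ k ∈ s, ∀ l ∈ s, k ≠ l → ∫ ω, f k ω * f l ω ∂P = 0) :
    ∫ ω, (∑ k ∈ s, f k ω) ^ 2 ∂P = ∑ k ∈ s, ∫ ω, f k ω ^ 2 ∂P := by
  have hint {k l : κ} (hk : k ∈ s) (hl : l ∈ s) : Integrable (fun ω ↦ f k ω * f l ω) P :=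
    (hf k hk).integrable_mul (hf l hl)
  simp_rw [sq, Finset.sum_mul_sum]
  rw [integral_finsetSum _ fun k hk ↦ integrable_finsetSum _ fun l hl ↦ hint hk hl]
  refine Finset.sum_congr rfl fun k hk ↦ ?_
  rw [integral_finsetSum _ fun l hl ↦ hint hk hl]
  exact Finset.sum_eq_single_of_mem k hk fun l hl hlk ↦ horth k hk l hl hlk.symm

lemma integral_eq_zero_of_comp_eq_neg {Ω : Type*} [MeasurableSpace Ω] {P : Measure Ω}
    {φ : Ω → Ω} (hφ : MeasurePreserving φ P P) {f : Ω → ℝ} (hf : AEStronglyMeasurable f P)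
    (hodd : ∀ ω, f (φ ω) = -f ω) : ∫ ω, f ω ∂P = 0 := by
  have hflip := hφ.hasLaw.integral_comp hf
  simp only [Function.comp_def, hodd, integral_neg] at hflip
  linarith

end ProductMeasure

section RotationInvariant

variable {E : Type*} [NormedAddCommGroup E] [InnerProductSpace ℝ E] [MeasurableSpace E]

/-- A measure on a real inner product space is rotation invariant if every linear isometry (not
necessarily orientation preserving) of the space onto itself leaves it unchanged. -/
def IsRotationInvariant (m : Measure E) : Prop :=
  ∀ e : E ≃ₗᵢ[ℝ] E, m.map e = m

namespace IsRotationInvariant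

variable [BorelSpace E] {m σ : Measure E}

lemma measurePreserving (hm : IsRotationInvariant m) (e : E ≃ₗᵢ[ℝ] E) :
    MeasurePreserving e m m :=
  ⟨e.continuous.measurable, hm e⟩

lemma measurePreserving_neg (hm : IsRotationInvariant m) : MeasurePreserving (fun x ↦ -x) m m :=
  hm.measurePreserving (LinearIsometryEquiv.neg ℝ)

lemma map_const_smul (hm : IsRotationInvariant m) (c : ℝ) :
    IsRotationInvariant (m.map fun x ↦ c • x) := fun e ↦ by
  have hcomm : e ∘ (fun x ↦ c • x) = (fun x ↦ c • x) ∘ e := funext fun x ↦ map_smul e c x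
  rw [Measure.map_map e.continuous.measurable (measurable_const_smul c), hcomm,
    ← Measure.map_map (measurable_const_smul c) e.continuous.measurable, hm e]

lemma map_inner_eq_of_norm_eq [SecondCountableTopology E] (hm : IsRotationInvariant m) {v w : E}
    (hvw : ‖v‖ = ‖w‖) : m.map (fun x ↦ inner ℝ x v) = m.map (fun x ↦ inner ℝ x w) := by
  let e := Submodule.reflection (ℝ ∙ (w - v))ᗮ
  have he : e w = v := Submodule.reflection_sub hvw.symm
  conv_lhs => rw [← hm e]
  rw [Measure.map_map (by fun_prop) e.continuous.measurable, ← he]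
  simp only [Function.comp_def, e.inner_map_map]

lemma charFun_eq_of_norm_eq [SecondCountableTopology E] (hm : IsRotationInvariant m) {s t : E}
    (hst : ‖s‖ = ‖t‖) : charFun m s = charFun m t := by
  have hcharFun (v : E) : charFun m v =
      ∫ y, Complex.exp (y * Complex.I) ∂(m.map fun x ↦ inner ℝ x v) := by
    rw [charFun_apply, integral_map (by fun_prop) (by fun_prop)]
  rw [hcharFun, hcharFun, hm.map_inner_eq_of_norm_eq hst]

lemma finrank_mul_integral_inner_sq [FiniteDimensional ℝ E] (hm : IsRotationInvariant m)
    (hm₂ : MemLp id 2 m) (v : E) :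
    Module.finrank ℝ E * ∫ x, inner ℝ x v ^ 2 ∂m = ‖v‖ ^ 2 * ∫ x, ‖x‖ ^ 2 ∂m := by
  let b := stdOrthonormalBasis ℝ E
  have hint (i) : Integrable (fun x ↦ inner ℝ x (b i) ^ 2) m :=
    (hm₂.inner_const (b i)).integrable_sq
  have hbasis (i) : ∫ x, inner ℝ x v ^ 2 ∂m = ‖v‖ ^ 2 * ∫ x, inner ℝ x (b i) ^ 2 ∂m := by
    have hmap (w : E) : ∫ x, inner ℝ x w ^ 2 ∂m = ∫ y, y ^ 2 ∂(m.map fun x ↦ inner ℝ x w) := by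
      rw [integral_map (by fun_prop) (by fun_prop)]
    rw [hmap, hm.map_inner_eq_of_norm_eq (w := ‖v‖ • b i) (by simp [norm_smul]), ← hmap,
      ← integral_const_mul]
    simp only [real_inner_smul_right, mul_pow]
  calc Module.finrank ℝ E * ∫ x, inner ℝ x v ^ 2 ∂m = ∑ _ : Fin (Module.finrank ℝ E),
        ∫ x, inner ℝ x v ^ 2 ∂m := by simp
    _ = ‖v‖ ^ 2 * ∑ i, ∫ x, inner ℝ x (b i) ^ 2 ∂m := by
        rw [Finset.mul_sum]
        exact Finset.sum_congr rfl fun i _ ↦ hbasis i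
    _ = ‖v‖ ^ 2 * ∫ x, ‖x‖ ^ 2 ∂m := by
        rw [← integral_finsetSum _ fun i _ ↦ hint i]
        simp only [b.sum_sq_inner_left]

/-- The polar decomposition of a rotation invariant probability measure `m`: any rotation invariant
`σ` on the unit sphere serves as the law of the direction. -/
lemma measurePreserving_smul_prod [SecondCountableTopology E] [CompleteSpace E]
    [IsProbabilityMeasure m] [IsProbabilityMeasure σ] (hm : IsRotationInvariant m)
    (hσ : IsRotationInvariant σ) (hσ_norm : ∀ᵐ u ∂σ, ‖u‖ = 1) :
    MeasurePreserving (fun z : ℝ × E ↦ z.1 • z.2) ((m.map norm).prod σ) m := by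
  have : IsProbabilityMeasure (m.map norm) := Measure.isProbabilityMeasure_map (by fun_prop)
  refine ⟨by fun_prop, Measure.ext_of_charFun (funext fun t ↦ ?_)⟩
  calc charFun (((m.map norm).prod σ).map fun z : ℝ × E ↦ z.1 • z.2) t
      = ∫ x, charFun σ (‖x‖ • t) ∂m := by
        rw [charFun_apply, integral_map (by fun_prop) (by fun_prop),
          integral_prod _ (integrable_exp_ofReal_mul_I (by fun_prop)), integral_map (by fun_prop)]
        · simp only [charFun_apply, real_inner_smul_left, real_inner_smul_right]
        · exact (integrable_exp_ofReal_mul_I (X := fun z : ℝ × E ↦ inner ℝ (z.1 • z.2) t)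
            (by fun_prop)).integral_prod_left.aestronglyMeasurable
    _ = ∫ x, charFun σ (‖t‖ • x) ∂m :=
        integral_congr_ae (.of_forall fun x ↦ hσ.charFun_eq_of_norm_eq (by
          simp only [norm_smul, norm_norm, mul_comm]))
    _ = ∫ u, charFun m (‖t‖ • u) ∂σ := by
        simp only [charFun_apply, real_inner_smul_right]
        rw [integral_integral_swap]
        · simp only [real_inner_comm]
        · exact integrable_exp_ofReal_mul_I (by fun_prop)
    _ = charFun m t := by
        rw [integral_congr_ae (g := fun _ ↦ charFun m t)]
        · simp
        · filter_upwards [hσ_norm] with u hu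
          exact hm.charFun_eq_of_norm_eq (by simp [norm_smul, hu])

end IsRotationInvariant

lemma isRotationInvariant_stdGaussian [BorelSpace E] [FiniteDimensional ℝ E] :
    IsRotationInvariant (stdGaussian E) :=
  stdGaussian_map

variable (d : ℕ)

open scoped Pointwise in
lemma uniformUnitSphere_apply {s : Set (EuclideanSpace ℝ (Fin d))} (hs : MeasurableSet s) :
    uniformUnitSphere d s =
      ((volume : Measure (EuclideanSpace ℝ (Fin d))).toSphere Set.univ)⁻¹ *
        (d * volume (Set.Ioo (0 : ℝ) 1 • (Metric.sphere 0 1 ∩ s))) := by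
  rw [uniformUnitSphere, Measure.map_apply measurable_subtype_coe hs, cond_apply .univ,
    Set.univ_inter, Measure.toSphere_apply' _ (measurable_subtype_coe hs),
    Subtype.image_preimage_coe, finrank_euclideanSpace_fin]

open scoped Pointwise in
lemma isRotationInvariant_uniformUnitSphere : IsRotationInvariant (uniformUnitSphere d) := by
  intro e
  ext s hs
  have hcone : Set.Ioo (0 : ℝ) 1 • (Metric.sphere 0 1 ∩ e ⁻¹' s) =
      e ⁻¹' (Set.Ioo (0 : ℝ) 1 • (Metric.sphere 0 1 ∩ s)) := by
    have himage (t : Set (EuclideanSpace ℝ (Fin d))) : e ⁻¹' t = e.symm '' t :=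
      (e.symm.image_eq_preimage_symm t).symm
    calc Set.Ioo (0 : ℝ) 1 • (Metric.sphere 0 1 ∩ e ⁻¹' s)
        = Set.Ioo (0 : ℝ) 1 • e ⁻¹' (Metric.sphere 0 1 ∩ s) := by
          rw [Set.preimage_inter, e.preimage_sphere, map_zero]
      _ = e ⁻¹' (Set.Ioo (0 : ℝ) 1 • (Metric.sphere 0 1 ∩ s)) := by
          rw [himage, himage]
          exact (Set.image_image2_distrib_right fun r x ↦ map_smul e.symm r x).symm
  have hes : MeasurableSet (e ⁻¹' s) := e.continuous.measurable hs
  rw [Measure.map_apply e.continuous.measurable hs, uniformUnitSphere_apply d hs,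
    uniformUnitSphere_apply d hes, hcone,
    e.measurePreserving.measure_preimage_emb e.toHomeomorph.measurableEmbedding]

instance isProbabilityMeasure_uniformUnitSphere [NeZero d] :
    IsProbabilityMeasure (uniformUnitSphere d) := by
  have : NeZero (volume : Measure (EuclideanSpace ℝ (Fin d))).toSphere :=
    ⟨Measure.toSphere_ne_zero _⟩
  have : IsProbabilityMeasure
      ((volume : Measure (EuclideanSpace ℝ (Fin d))).toSphere[|Set.univ]) :=
    cond_isProbabilityMeasure (NeZero.ne _)
  exact Measure.isProbabilityMeasure_map (by fun_prop)

lemma ae_norm_eq_one_uniformUnitSphere : ∀ᵐ u ∂uniformUnitSphere d, ‖u‖ = 1 := by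
  rw [uniformUnitSphere,
    ae_map_iff (by fun_prop) (measurableSet_eq_fun (by fun_prop) (by fun_prop))]
  exact .of_forall fun u ↦ norm_eq_of_mem_sphere u

end RotationInvariant

section GaussianMoments

lemma iteratedDeriv_exp_sq_div_two (k : ℕ) :
    iteratedDeriv k (fun t : ℝ ↦ Real.exp (t ^ 2 / 2)) = fun t ↦
      ((fun p : Polynomial ℝ ↦ p.derivative + Polynomial.X * p)^[k] 1).eval t *
        Real.exp (t ^ 2 / 2) := by
  induction k with
  | zero => simp
  | succ k ih =>
    rw [iteratedDeriv_succ, ih]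
    ext t
    have hexp : HasDerivAt (fun t : ℝ ↦ Real.exp (t ^ 2 / 2)) (Real.exp (t ^ 2 / 2) * t) t := by
      simpa using ((hasDerivAt_pow 2 t).div_const 2).exp
    rw [((Polynomial.hasDerivAt _ t).fun_mul hexp).deriv, Function.iterate_succ_apply']
    simp only [Polynomial.eval_add, Polynomial.eval_mul, Polynomial.eval_X]
    ring

lemma integral_pow_gaussianReal (k : ℕ) :
    ∫ x, x ^ k ∂(gaussianReal 0 1) =
      ((fun p : Polynomial ℝ ↦ p.derivative + Polynomial.X * p)^[k] 1).eval 0 := by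
  have hmoment := iteratedDeriv_mgf_zero (X := id) (μ := gaussianReal 0 1)
    (by simp [integrableExpSet_id_gaussianReal]) k
  simpa [mgf_id_gaussianReal, iteratedDeriv_exp_sq_div_two] using hmoment.symm

lemma integral_pow_two_gaussianReal : ∫ x, x ^ 2 ∂(gaussianReal 0 1) = 1 := by
  rw [integral_pow_gaussianReal]
  simp

lemma integral_pow_four_gaussianReal : ∫ x, x ^ 4 ∂(gaussianReal 0 1) = 3 := by
  rw [integral_pow_gaussianReal]
  simp only [Function.iterate_succ_apply', Function.iterate_zero, id_eq, map_add,
    Polynomial.derivative_mul, Polynomial.derivative_X, Polynomial.derivative_one,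
    Polynomial.eval_add, Polynomial.eval_mul, Polynomial.eval_X, Polynomial.eval_one,
    Polynomial.eval_zero]
  norm_num

lemma memLp_sq_gaussianReal : MemLp (fun x ↦ x ^ 2) 2 (gaussianReal 0 1) := by
  rw [memLp_two_iff_integrable_sq (by fun_prop)]
  simpa [← pow_mul, Even.pow_abs (show Even 4 by decide)] using
    (memLp_id_gaussianReal (μ := 0) (v := 1) 4).integrable_norm_pow (by norm_num)

lemma memLp_sq_sub_one_gaussianReal : MemLp (fun x ↦ x ^ 2 - 1) 2 (gaussianReal 0 1) :=
  memLp_sq_gaussianReal.sub (memLp_const 1)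

lemma integral_sq_sub_one_gaussianReal : ∫ x, (x ^ 2 - 1) ∂(gaussianReal 0 1) = 0 := by
  rw [integral_sub (memLp_sq_gaussianReal.integrable one_le_two) (integrable_const 1),
    integral_pow_two_gaussianReal]
  simp

lemma integral_sq_sub_one_sq_gaussianReal : ∫ x, (x ^ 2 - 1) ^ 2 ∂(gaussianReal 0 1) = 2 := by
  rw [← variance_of_integral_eq_zero (by fun_prop) integral_sq_sub_one_gaussianReal,
    variance_sub_const (by fun_prop), variance_eq_sub memLp_sq_gaussianReal,
    integral_pow_two_gaussianReal]
  simp only [Pi.pow_apply, ← pow_mul]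
  norm_num [integral_pow_four_gaussianReal]

variable (d : ℕ)

lemma map_norm_sq_sub_stdGaussian :
    (stdGaussian (EuclideanSpace ℝ (Fin d))).map (fun x ↦ ‖x‖ ^ 2 - d) =
      (Measure.pi fun _ : Fin d ↦ gaussianReal 0 1).map fun y ↦ ∑ i, (y i ^ 2 - 1) := by
  rw [← map_pi_eq_stdGaussian, Measure.map_map (by fun_prop) (by fun_prop)]
  simp [Function.comp_def, EuclideanSpace.real_norm_sq_eq]

lemma charFun_map_norm_sq_sub_stdGaussian (t : ℝ) :
    charFun ((stdGaussian (EuclideanSpace ℝ (Fin d))).map fun x ↦ ‖x‖ ^ 2 - d) t =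
      charFun ((gaussianReal 0 1).map fun x ↦ x ^ 2 - 1) t ^ d := by
  rw [map_norm_sq_sub_stdGaussian, charFun_map_sum_comp_eval_pi (f := fun _ x ↦ x ^ 2 - 1)
    (fun _ ↦ by fun_prop)]
  simp

lemma integral_norm_sq_sub_sq_stdGaussian :
    ∫ x, (‖x‖ ^ 2 - d) ^ 2 ∂stdGaussian (EuclideanSpace ℝ (Fin d)) = (2 * d : ℝ) := by
  have hmap := congrArg (fun ρ ↦ ∫ x, x ^ 2 ∂ρ) (map_norm_sq_sub_stdGaussian d)
  simp only [] at hmap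
  rw [integral_map (by fun_prop) (by fun_prop),
    integral_map (Measurable.aemeasurable (by fun_prop)) (by fun_prop),
    integral_sq_sum_comp_eval_pi (f := fun _ x ↦ x ^ 2 - 1) (fun _ ↦ memLp_sq_sub_one_gaussianReal)
      fun _ ↦ integral_sq_sub_one_gaussianReal] at hmap
  simpa [integral_sq_sub_one_sq_gaussianReal, mul_comm] using hmap

lemma integral_norm_sq_stdGaussian :
    ∫ x, ‖x‖ ^ 2 ∂stdGaussian (EuclideanSpace ℝ (Fin d)) = (d : ℝ) := by
  rw [← map_pi_eq_stdGaussian, integral_map (by fun_prop) (by fun_prop)]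
  simp only [EuclideanSpace.real_norm_sq_eq]
  rw [integral_sum_comp_eval_pi (f := fun _ x ↦ x ^ 2)
    fun _ ↦ memLp_sq_gaussianReal.integrable one_le_two]
  simp [integral_pow_two_gaussianReal]

lemma memLp_norm_sq_stdGaussian :
    MemLp (fun x ↦ ‖x‖ ^ 2) 2 (stdGaussian (EuclideanSpace ℝ (Fin d))) := by
  rw [memLp_two_iff_integrable_sq (by fun_prop)]
  simpa [← pow_mul] using
    (IsGaussian.memLp_id (stdGaussian (EuclideanSpace ℝ (Fin d))) 4
      (by simp)).integrable_norm_pow (by norm_num)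

/-- The centered Gaussian distribution on `ℝ^d` with covariance matrix `1 / d`, normalized so that
the squared norm has mean `1`, as for a uniform vector of the unit sphere. -/
noncomputable def normalizedGaussian : Measure (EuclideanSpace ℝ (Fin d)) :=
  (stdGaussian (EuclideanSpace ℝ (Fin d))).map fun x ↦ (√d)⁻¹ • x

instance isProbabilityMeasure_normalizedGaussian : IsProbabilityMeasure (normalizedGaussian d) :=
  Measure.isProbabilityMeasure_map (by fun_prop)

lemma isRotationInvariant_normalizedGaussian : IsRotationInvariant (normalizedGaussian d) :=
  isRotationInvariant_stdGaussian.map_const_smul _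

lemma memLp_norm_sq_normalizedGaussian : MemLp (fun x ↦ ‖x‖ ^ 2) 2 (normalizedGaussian d) := by
  rw [normalizedGaussian, memLp_map_measure_iff (by fun_prop) (by fun_prop)]
  simpa [Function.comp_def, norm_smul, mul_pow] using (memLp_norm_sq_stdGaussian d).const_mul _

lemma integral_norm_sq_normalizedGaussian [NeZero d] :
    ∫ x, ‖x‖ ^ 2 ∂normalizedGaussian d = (1 : ℝ) := by
  rw [normalizedGaussian, integral_map (by fun_prop) (by fun_prop)]
  simp [norm_smul, mul_pow, integral_const_mul, integral_norm_sq_stdGaussian, NeZero.ne]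

lemma integral_norm_sq_sub_one_sq_normalizedGaussian [NeZero d] :
    ∫ x, (‖x‖ ^ 2 - 1) ^ 2 ∂normalizedGaussian d = (2 / d : ℝ) := by
  have hd : (d : ℝ) ≠ 0 := NeZero.ne _
  have hscale (x : EuclideanSpace ℝ (Fin d)) :
      (‖(√d)⁻¹ • x‖ ^ 2 - 1) ^ 2 = (d : ℝ)⁻¹ ^ 2 * (‖x‖ ^ 2 - d) ^ 2 := by
    rw [norm_smul, mul_pow, Real.norm_eq_abs, sq_abs, inv_pow, Real.sq_sqrt d.cast_nonneg]
    field_simp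
  rw [normalizedGaussian, integral_map (by fun_prop) (by fun_prop)]
  simp only [hscale]
  rw [integral_const_mul, integral_norm_sq_sub_sq_stdGaussian]
  field_simp

lemma map_sum_smul_pi_normalizedGaussian {ι : Type*} [Fintype ι] (w : ι → ℝ) :
    (Measure.pi fun _ : ι ↦ normalizedGaussian d).map (fun x ↦ ∑ i, w i • x i) =
      (stdGaussian (EuclideanSpace ℝ (Fin d))).map fun x ↦ √((∑ i, w i ^ 2) / d) • x := by
  have hnonneg : 0 ≤ (∑ i, w i ^ 2) / d :=
    div_nonneg (Finset.sum_nonneg fun i _ ↦ sq_nonneg (w i)) d.cast_nonneg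
  refine Measure.ext_of_charFun (funext fun t ↦ ?_)
  rw [charFun_map_sum_comp_eval_pi (f := fun i x ↦ w i • x) fun _ ↦ by fun_prop]
  simp only [normalizedGaussian, charFun_map_smul, charFun_stdGaussian, norm_smul]
  rw [← Complex.exp_sum]
  congr 1
  norm_cast
  simp only [mul_pow, Real.norm_eq_abs, sq_abs, inv_pow, Real.sq_sqrt d.cast_nonneg,
    Real.sq_sqrt hnonneg]
  simp only [Finset.sum_div, Finset.sum_mul, ← Finset.sum_neg_distrib]
  exact Finset.sum_congr rfl fun i _ ↦ by ring

lemma map_norm_sq_sum_smul_pi_normalizedGaussian {ι : Type*} [Fintype ι] (w : ι → ℝ) :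
    (Measure.pi fun _ : ι ↦ normalizedGaussian d).map (fun x ↦ ‖∑ i, w i • x i‖ ^ 2) =
      (stdGaussian (EuclideanSpace ℝ (Fin d))).map fun x ↦ (∑ i, w i ^ 2) / d * ‖x‖ ^ 2 := by
  have hnonneg : 0 ≤ (∑ i, w i ^ 2) / d :=
    div_nonneg (Finset.sum_nonneg fun i _ ↦ sq_nonneg (w i)) d.cast_nonneg
  have hmap := congrArg (Measure.map fun x ↦ ‖x‖ ^ 2) (map_sum_smul_pi_normalizedGaussian d w)
  rw [Measure.map_map (by fun_prop) (Continuous.measurable (by fun_prop)),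
    Measure.map_map (by fun_prop) (by fun_prop)] at hmap
  simpa only [Function.comp_def, norm_smul, mul_pow, Real.norm_eq_abs, sq_abs,
    Real.sq_sqrt hnonneg] using hmap

end GaussianMoments

section PairKernel

variable {ι : Type*} [Fintype ι] [LinearOrder ι]

lemma sum_prod_eq_sum_diag_add_two_mul_sum_lt {R : Type*} [CommSemiring R] {F : ι × ι → R}
    (hF : ∀ p, F p.swap = F p) :
    ∑ p, F p = ∑ i, F (i, i) + 2 * ∑ p with p.1 < p.2, F p := by
  have hgt : ∑ p with p.2 < p.1, F p = ∑ p with p.1 < p.2, F p :=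
    Finset.sum_equiv (Equiv.prodComm ι ι) (by simp) fun p _ ↦ (hF p).symm
  have hdiag : ∑ p with p.1 = p.2, F p = ∑ i, F (i, i) :=
    Finset.sum_nbij' Prod.fst (fun i ↦ (i, i)) (by simp) (by simp) (by simp) (by simp) (by simp)
  have hge : ∑ p with ¬p.1 < p.2, F p = ∑ p with p.1 = p.2, F p + ∑ p with p.2 < p.1, F p := by
    rw [← Finset.sum_union (Finset.disjoint_filter.2 fun p _ h ↦ h.not_gt), ← Finset.filter_or]
    simp only [not_lt, le_iff_eq_or_lt, eq_comm]
  rw [← Finset.sum_filter_add_sum_filter_not Finset.univ (fun p : ι × ι ↦ p.1 < p.2), hge, hgt,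
    hdiag]
  ring

lemma norm_sum_sq_eq {E : Type*} [NormedAddCommGroup E] [InnerProductSpace ℝ E] (x : ι → E) :
    ‖∑ i, x i‖ ^ 2 = ∑ i, ‖x i‖ ^ 2 + 2 * ∑ p : ι × ι with p.1 < p.2, inner ℝ (x p.1) (x p.2) := by
  rw [← real_inner_self_eq_norm_sq, sum_inner]
  simp only [inner_sum, ← real_inner_self_eq_norm_sq]
  rw [← Fintype.sum_prod_type' fun i j ↦ inner ℝ (x i) (x j)]
  exact sum_prod_eq_sum_diag_add_two_mul_sum_lt fun p ↦ real_inner_comm _ _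

lemma two_mul_sum_lt_sq_mul_sq_le (w : ι → ℝ) :
    2 * ∑ p : ι × ι with p.1 < p.2, w p.1 ^ 2 * w p.2 ^ 2 ≤ Fintype.card ι * ∑ i, w i ^ 4 := by
  have hsum := sum_prod_eq_sum_diag_add_two_mul_sum_lt (F := fun p ↦ w p.1 ^ 2 * w p.2 ^ 2)
    fun p ↦ mul_comm _ _
  have hdiag : 0 ≤ ∑ i, w i ^ 2 * w i ^ 2 := Finset.sum_nonneg fun i _ ↦ by positivity
  calc 2 * ∑ p : ι × ι with p.1 < p.2, w p.1 ^ 2 * w p.2 ^ 2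
      ≤ ∑ p : ι × ι, w p.1 ^ 2 * w p.2 ^ 2 := by linarith
    _ = (∑ i, w i ^ 2) ^ 2 := by
        rw [sq, Finset.sum_mul_sum, Fintype.sum_prod_type]
    _ ≤ Fintype.card ι * ∑ i, (w i ^ 2) ^ 2 := sq_sum_le_card_mul_sum_sq
    _ = Fintype.card ι * ∑ i, w i ^ 4 := by simp only [← pow_mul]

lemma exists_mem_pair_notMem_pair {α : Type*} [LinearOrder α] {p q : α × α} (hp : p.1 < p.2)
    (hq : q.1 < q.2) (hpq : p ≠ q) : ∃ m, (m = p.1 ∨ m = p.2) ∧ m ≠ q.1 ∧ m ≠ q.2 := by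
  by_contra! hcon
  have h₁ : p.1 = q.1 ∨ p.1 = q.2 := or_iff_not_imp_left.2 (hcon p.1 (.inl rfl))
  have h₂ : p.2 = q.1 ∨ p.2 = q.2 := or_iff_not_imp_left.2 (hcon p.2 (.inr rfl))
  rcases h₁ with h₁ | h₁ <;> rcases h₂ with h₂ | h₂
  · exact hp.ne (h₁.trans h₂.symm)
  · exact hpq (Prod.ext h₁ h₂)
  · exact lt_asymm hp (h₁ ▸ h₂ ▸ hq)
  · exact hp.ne (h₁.trans h₂.symm)

variable {X : Type*} [MeasurableSpace X] {κ : Measure X} [IsProbabilityMeasure κ] {φ : X → X}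
  {k : X → X → ℝ}

lemma integral_pair_mul_pair_eq_zero (hφ : MeasurePreserving φ κ κ)
    (hk_left : ∀ x y, k (φ x) y = -k x y) (hk_right : ∀ x y, k x (φ y) = -k x y)
    (hk : MemLp (fun z : X × X ↦ k z.1 z.2) 2 (κ.prod κ)) {p q : ι × ι} (hp : p.1 < p.2)
    (hq : q.1 < q.2) (hpq : p ≠ q) :
    ∫ x, k (x p.1) (x p.2) * k (x q.1) (x q.2) ∂(Measure.pi fun _ ↦ κ) = 0 := by
  have hmemLp {r : ι × ι} (hr : r.1 < r.2) :
      MemLp (fun x : ι → X ↦ k (x r.1) (x r.2)) 2 (Measure.pi fun _ ↦ κ) :=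
    hk.comp_measurePreserving (measurePreserving_eval_pair_pi κ hr.ne)
  obtain ⟨m, hm, hmq⟩ := exists_mem_pair_notMem_pair hp hq hpq
  let flip (i : ι) : X → X := if i = m then φ else id
  have hflip : MeasurePreserving (fun (x : ι → X) i ↦ flip i (x i)) (Measure.pi fun _ ↦ κ)
      (Measure.pi fun _ ↦ κ) := by
    refine measurePreserving_pi _ _ fun i ↦ ?_
    by_cases him : i = m
    · simpa [flip, him] using hφ
    · simpa [flip, him] using MeasurePreserving.id κ
  refine integral_eq_zero_of_comp_eq_neg hflip
    ((hmemLp hp).integrable_mul (hmemLp hq)).aestronglyMeasurable fun x ↦ ?_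
  have hq_flip : flip q.1 = id ∧ flip q.2 = id := by
    simp [flip, hmq.1.symm, hmq.2.symm]
  rcases hm with rfl | rfl
  · simp [hq_flip, flip, hk_left, hp.ne']
  · simp [hq_flip, flip, hk_right, hp.ne]

lemma integral_sq_sum_pair (hφ : MeasurePreserving φ κ κ)
    (hk_left : ∀ x y, k (φ x) y = -k x y) (hk_right : ∀ x y, k x (φ y) = -k x y)
    (hk : MemLp (fun z : X × X ↦ k z.1 z.2) 2 (κ.prod κ)) (c : ι × ι → ℝ) :
    ∫ x, (∑ p with p.1 < p.2, c p * k (x p.1) (x p.2)) ^ 2 ∂(Measure.pi fun _ ↦ κ) =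
      (∑ p with p.1 < p.2, c p ^ 2) * ∫ z, k z.1 z.2 ^ 2 ∂(κ.prod κ) := by
  have hpair {p : ι × ι} (hp : p.1 < p.2) := measurePreserving_eval_pair_pi κ hp.ne
  rw [integral_sq_sum_of_orthogonal, Finset.sum_mul]
  · refine Finset.sum_congr rfl fun p hp ↦ ?_
    simp only [mul_pow, integral_const_mul]
    rw [← (hpair (Finset.mem_filter.1 hp).2).hasLaw.integral_comp
      hk.integrable_sq.aestronglyMeasurable]
    rfl
  · exact fun p hp ↦ (hk.comp_measurePreserving (hpair (Finset.mem_filter.1 hp).2)).const_mul _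
  · intro p hp q hq hpq
    have horth := integral_pair_mul_pair_eq_zero hφ hk_left hk_right hk
      (Finset.mem_filter.1 hp).2 (Finset.mem_filter.1 hq).2 hpq
    simp only [mul_mul_mul_comm, integral_const_mul, horth, mul_zero]

end PairKernel

section RadialLaw

variable {ρ : Measure ℝ} [IsProbabilityMeasure ρ]

lemma integral_add_mul_add_mul_sq (hρ : MemLp id 2 ρ) (c₀ c₁ c₂ : ℝ) :
    ∫ a, (c₀ + c₁ * a + c₂ * a ^ 2) ∂ρ = c₀ + c₁ * ∫ a, a ∂ρ + c₂ * ∫ a, a ^ 2 ∂ρ := by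
  have hint : Integrable (fun a ↦ c₁ * a) ρ := (hρ.integrable one_le_two).const_mul c₁
  have hint_sq : Integrable (fun a ↦ c₂ * a ^ 2) ρ := hρ.integrable_sq.const_mul c₂
  rw [integral_add (f := fun a ↦ c₀ + c₁ * a) ((integrable_const c₀).add hint) hint_sq,
    integral_add (integrable_const c₀) hint, integral_const_mul, integral_const_mul,
    integral_const, probReal_univ, one_smul]

lemma two_sub_two_mul_sq_integral_le (hρ_nonneg : ∀ᵐ a ∂ρ, 0 ≤ a)
    (hρ : MemLp (fun a ↦ a ^ 2) 2 ρ) (hρ_sq : ∫ a, a ^ 2 ∂ρ = 1) :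
    2 - 2 * (∫ a, a ∂ρ) ^ 2 ≤ 2 * ∫ a, (a ^ 2 - 1) ^ 2 ∂ρ := by
  have hint_sq : Integrable (fun a ↦ a ^ 2) ρ := hρ.integrable one_le_two
  have hmemLp : MemLp id 2 ρ := (memLp_two_iff_integrable_sq (by fun_prop)).2 hint_sq
  have hsub : ∫ a, (a - 1) ^ 2 ∂ρ = 2 - 2 * ∫ a, a ∂ρ := by
    have hexpand (a : ℝ) : (a - 1) ^ 2 = 1 + -2 * a + 1 * a ^ 2 := by ring
    simp only [hexpand, integral_add_mul_add_mul_sq hmemLp, hρ_sq]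
    ring
  have hle : ∫ a, (a - 1) ^ 2 ∂ρ ≤ ∫ a, (a ^ 2 - 1) ^ 2 ∂ρ := by
    refine integral_mono_of_nonneg (.of_forall fun a ↦ sq_nonneg _)
      (hρ.sub (memLp_const 1)).integrable_sq ?_
    filter_upwards [hρ_nonneg] with a ha
    have hfactor : (a ^ 2 - 1) ^ 2 = (a - 1) ^ 2 * (1 + a) ^ 2 := by ring
    rw [hfactor]
    exact le_mul_of_one_le_right (sq_nonneg _) (one_le_pow₀ (by linarith))
  nlinarith [sq_nonneg (1 - ∫ a, a ∂ρ)]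

variable {Y ι : Type*} [MeasurableSpace Y] [Fintype ι] {τ : Measure Y} [IsProbabilityMeasure τ]

lemma memLp_sum_mul_one_sub_sq (hρ : MemLp (fun a ↦ a ^ 2) 2 ρ) (w : ι → ℝ) :
    MemLp (fun z : ι → ℝ × Y ↦ ∑ i, w i ^ 2 * (1 - (z i).1 ^ 2)) 2
      (Measure.pi fun _ ↦ ρ.prod τ) :=
  memLp_finsetSum _ fun i _ ↦ (((memLp_const 1).sub hρ).comp_fst τ).const_mul (w i ^ 2)
    |>.comp_measurePreserving (measurePreserving_eval _ i)

lemma integral_sq_sum_mul_one_sub_sq (hρ : MemLp (fun a ↦ a ^ 2) 2 ρ)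
    (hρ_sq : ∫ a, a ^ 2 ∂ρ = 1) (w : ι → ℝ) :
    ∫ z : ι → ℝ × Y, (∑ i, w i ^ 2 * (1 - (z i).1 ^ 2)) ^ 2 ∂(Measure.pi fun _ ↦ ρ.prod τ) =
      (∑ i, w i ^ 4) * ∫ a, (a ^ 2 - 1) ^ 2 ∂ρ := by
  have hint_sq : Integrable (fun a ↦ a ^ 2) ρ := hρ.integrable one_le_two
  rw [integral_sq_sum_comp_eval_pi (f := fun i (z : ℝ × Y) ↦ w i ^ 2 * (1 - z.1 ^ 2)),
    Finset.sum_mul]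
  · refine Finset.sum_congr rfl fun i _ ↦ ?_
    rw [integral_fun_fst (μ := ρ) (ν := τ) fun a ↦ (w i ^ 2 * (1 - a ^ 2)) ^ 2, probReal_univ,
      one_smul, ← integral_const_mul]
    exact integral_congr_ae (.of_forall fun a ↦ by ring)
  · exact fun i ↦ (((memLp_const 1).sub hρ).comp_fst τ).const_mul (w i ^ 2)
  · intro i
    rw [integral_fun_fst (μ := ρ) (ν := τ) fun a ↦ w i ^ 2 * (1 - a ^ 2), integral_const_mul,
      integral_sub (integrable_const 1) hint_sq, hρ_sq]
    simp

end RadialLaw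

section RadialFactors

variable {ι E : Type*} [Fintype ι] [LinearOrder ι] [NormedAddCommGroup E]
  [InnerProductSpace ℝ E]

/-- For pairs `(a, u)` of a radius and a direction, the change `⟪u, u'⟫ - ⟪a • u, a' • u'⟫` of the
inner product when the directions are multiplied by their radii. -/
def innerDefect (y z : ℝ × E) : ℝ :=
  inner ℝ y.2 z.2 - inner ℝ (y.1 • y.2) (z.1 • z.2)

lemma innerDefect_eq_mul (y z : ℝ × E) :
    innerDefect y z = (1 - y.1 * z.1) * inner ℝ y.2 z.2 := by
  rw [innerDefect, real_inner_smul_left, real_inner_smul_right]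
  ring

lemma innerDefect_neg_left (y z : ℝ × E) : innerDefect (y.1, -y.2) z = -innerDefect y z := by
  simp [innerDefect_eq_mul]

lemma innerDefect_neg_right (y z : ℝ × E) : innerDefect y (z.1, -z.2) = -innerDefect y z := by
  simp [innerDefect_eq_mul]

lemma norm_sum_smul_sq_sub_norm_sum_smul_sq (w : ι → ℝ)
    {z : ι → ℝ × E} (hz : ∀ i, ‖(z i).2‖ = 1) :
    ‖∑ i, w i • (z i).2‖ ^ 2 - ‖∑ i, w i • (z i).1 • (z i).2‖ ^ 2 =
      ∑ i, w i ^ 2 * (1 - (z i).1 ^ 2) +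
        2 * ∑ p : ι × ι with p.1 < p.2, w p.1 * w p.2 * innerDefect (z p.1) (z p.2) := by
  rw [norm_sum_sq_eq, norm_sum_sq_eq, add_sub_add_comm, ← mul_sub, ← Finset.sum_sub_distrib,
    ← Finset.sum_sub_distrib]
  refine congrArg₂ (· + ·) (Finset.sum_congr rfl fun i _ ↦ ?_)
    (congrArg (2 * ·) (Finset.sum_congr rfl fun p _ ↦ ?_))
  · simp only [norm_smul, mul_pow, hz, Real.norm_eq_abs, sq_abs]
    ring
  · simp only [innerDefect, real_inner_smul_left, real_inner_smul_right]
    ring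

variable [MeasurableSpace E] {σ : Measure E} [IsProbabilityMeasure σ]
  {ρ : Measure ℝ} [IsProbabilityMeasure ρ]

lemma ae_norm_sum_smul_sq_sub_norm_sum_smul_sq (hσ_norm : ∀ᵐ u ∂σ, ‖u‖ = 1) (w : ι → ℝ) :
    ∀ᵐ z ∂(Measure.pi fun _ : ι ↦ ρ.prod σ),
      ‖∑ i, w i • (z i).2‖ ^ 2 - ‖∑ i, w i • (z i).1 • (z i).2‖ ^ 2 =
        ∑ i, w i ^ 2 * (1 - (z i).1 ^ 2) +
          2 * ∑ p : ι × ι with p.1 < p.2, w p.1 * w p.2 * innerDefect (z p.1) (z p.2) := by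
  have hnorm : ∀ᵐ z ∂(Measure.pi fun _ : ι ↦ ρ.prod σ), ∀ i, ‖(z i).2‖ = 1 :=
    ae_all_iff.2 fun i ↦ (measurePreserving_eval (fun _ : ι ↦ ρ.prod σ) i).quasiMeasurePreserving.ae
      (Measure.quasiMeasurePreserving_snd.ae hσ_norm)
  filter_upwards [hnorm] with z hz
  exact norm_sum_smul_sq_sub_norm_sum_smul_sq w hz

variable [BorelSpace E] [FiniteDimensional ℝ E]

lemma measurable_innerDefect : Measurable fun z : (ℝ × E) × ℝ × E ↦ innerDefect z.1 z.2 := by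
  unfold innerDefect
  fun_prop

lemma integral_inner_sq_eq_inv_finrank (hσ : IsRotationInvariant σ)
    (hσ_norm : ∀ᵐ u ∂σ, ‖u‖ = 1) {v : E} (hv : ‖v‖ = 1) :
    ∫ u, inner ℝ v u ^ 2 ∂σ = (Module.finrank ℝ E : ℝ)⁻¹ := by
  have hmemLp : MemLp id 2 σ := .of_bound (by fun_prop) 1 (hσ_norm.mono fun u hu ↦ hu.le)
  have hnorm : ∫ u, ‖u‖ ^ 2 ∂σ = (1 : ℝ) := by
    rw [integral_congr_ae (g := fun _ ↦ 1) (hσ_norm.mono fun u hu ↦ by simp [hu])]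
    simp
  have hmul := hσ.finrank_mul_integral_inner_sq hmemLp v
  rw [hv, hnorm, one_pow, one_mul] at hmul
  simp only [real_inner_comm _ v]
  exact eq_inv_of_mul_eq_one_right hmul

lemma memLp_innerDefect (hσ_norm : ∀ᵐ u ∂σ, ‖u‖ = 1) (hρ : MemLp id 2 ρ) :
    MemLp (fun z : (ℝ × E) × ℝ × E ↦ innerDefect z.1 z.2) 2
      ((ρ.prod σ).prod (ρ.prod σ)) := by
  have hfst : MemLp (fun z : ℝ × E ↦ z.1) 2 (ρ.prod σ) := hρ.comp_fst σ
  have hnorm : ∀ᵐ z ∂(ρ.prod σ), ‖z.2‖ = 1 := Measure.quasiMeasurePreserving_snd.ae hσ_norm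
  refine ((memLp_const 1).sub (memLp_mul_prod hfst hfst)).mono
    measurable_innerDefect.aestronglyMeasurable ?_
  filter_upwards [Measure.quasiMeasurePreserving_fst.ae hnorm,
    Measure.quasiMeasurePreserving_snd.ae hnorm] with z hz₁ hz₂
  rw [innerDefect_eq_mul, norm_mul]
  refine mul_le_of_le_one_right (norm_nonneg _) ((norm_inner_le_norm _ _).trans ?_)
  rw [hz₁, hz₂, one_mul]

lemma integral_innerDefect_sq (hσ : IsRotationInvariant σ) (hσ_norm : ∀ᵐ u ∂σ, ‖u‖ = 1)
    (hρ : MemLp id 2 ρ) (hρ_sq : ∫ a, a ^ 2 ∂ρ = 1) :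
    ∫ z, innerDefect z.1 z.2 ^ 2 ∂((ρ.prod σ).prod (ρ.prod σ)) =
      (2 - 2 * (∫ a, a ∂ρ) ^ 2) / Module.finrank ℝ E := by
  have hinner : ∀ᵐ y ∂(ρ.prod σ), ∫ z, innerDefect y z ^ 2 ∂(ρ.prod σ) =
      (1 + -2 * (∫ a, a ∂ρ) * y.1 + 1 * y.1 ^ 2) * (Module.finrank ℝ E : ℝ)⁻¹ := by
    filter_upwards [Measure.quasiMeasurePreserving_snd.ae hσ_norm] with y hy
    simp only [innerDefect_eq_mul, mul_pow]
    rw [integral_prod_mul (fun a ↦ (1 - y.1 * a) ^ 2) fun u ↦ inner ℝ y.2 u ^ 2,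
      integral_inner_sq_eq_inv_finrank hσ hσ_norm hy]
    have hexpand (a : ℝ) : (1 - y.1 * a) ^ 2 = 1 + -2 * y.1 * a + y.1 ^ 2 * a ^ 2 := by ring
    simp only [hexpand, integral_add_mul_add_mul_sq hρ, hρ_sq]
    ring
  rw [integral_prod _ (memLp_innerDefect hσ_norm hρ).integrable_sq, integral_congr_ae hinner,
    integral_mul_const, integral_fun_fst (μ := ρ) (ν := σ)
      fun a ↦ 1 + -2 * (∫ a, a ∂ρ) * a + 1 * a ^ 2, integral_add_mul_add_mul_sq hρ, hρ_sq,
    probReal_univ, one_smul]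
  ring

lemma memLp_sum_innerDefect (hσ_norm : ∀ᵐ u ∂σ, ‖u‖ = 1) (hρ : MemLp id 2 ρ) (c : ι × ι → ℝ) :
    MemLp (fun z : ι → ℝ × E ↦ ∑ p with p.1 < p.2, c p * innerDefect (z p.1) (z p.2)) 2
      (Measure.pi fun _ ↦ ρ.prod σ) :=
  memLp_finsetSum _ fun p hp ↦ ((memLp_innerDefect hσ_norm hρ).comp_measurePreserving
    (measurePreserving_eval_pair_pi _ (Finset.mem_filter.1 hp).2.ne)).const_mul (c p)

lemma integral_sq_sum_innerDefect_le (hσ : IsRotationInvariant σ) (hσ_norm : ∀ᵐ u ∂σ, ‖u‖ = 1)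
    (hρ_nonneg : ∀ᵐ a ∂ρ, 0 ≤ a) (hρ : MemLp (fun a ↦ a ^ 2) 2 ρ) (hρ_sq : ∫ a, a ^ 2 ∂ρ = 1)
    (w : ι → ℝ) :
    ∫ z : ι → ℝ × E, (∑ p : ι × ι with p.1 < p.2, w p.1 * w p.2 * innerDefect (z p.1) (z p.2)) ^ 2
        ∂(Measure.pi fun _ ↦ ρ.prod σ) ≤
      Fintype.card ι / Module.finrank ℝ E * (∑ i, w i ^ 4) * ∫ a, (a ^ 2 - 1) ^ 2 ∂ρ := by
  have hmemLp : MemLp id 2 ρ :=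
    (memLp_two_iff_integrable_sq (by fun_prop)).2 (hρ.integrable one_le_two)
  have hflip : MeasurePreserving (fun z : ℝ × E ↦ (z.1, -z.2)) (ρ.prod σ) (ρ.prod σ) :=
    (MeasurePreserving.id ρ).prod hσ.measurePreserving_neg
  rw [integral_sq_sum_pair hflip innerDefect_neg_left innerDefect_neg_right
    (memLp_innerDefect hσ_norm hmemLp), integral_innerDefect_sq hσ hσ_norm hmemLp hρ_sq]
  simp only [mul_pow]
  have hv := two_sub_two_mul_sq_integral_le hρ_nonneg hρ hρ_sq
  have hw := two_mul_sum_lt_sq_mul_sq_le w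
  have hw_nonneg : 0 ≤ ∑ p : ι × ι with p.1 < p.2, w p.1 ^ 2 * w p.2 ^ 2 :=
    Finset.sum_nonneg fun p _ ↦ by positivity
  have hv_nonneg : 0 ≤ ∫ a, (a ^ 2 - 1) ^ 2 ∂ρ := integral_nonneg fun a ↦ sq_nonneg _
  calc (∑ p : ι × ι with p.1 < p.2, w p.1 ^ 2 * w p.2 ^ 2) *
        ((2 - 2 * (∫ a, a ∂ρ) ^ 2) / Module.finrank ℝ E)
      ≤ (∑ p : ι × ι with p.1 < p.2, w p.1 ^ 2 * w p.2 ^ 2) *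
        (2 * (∫ a, (a ^ 2 - 1) ^ 2 ∂ρ) / Module.finrank ℝ E) :=
        mul_le_mul_of_nonneg_left (by gcongr) hw_nonneg
    _ = (2 * ∑ p : ι × ι with p.1 < p.2, w p.1 ^ 2 * w p.2 ^ 2) *
        ((∫ a, (a ^ 2 - 1) ^ 2 ∂ρ) / Module.finrank ℝ E) := by ring
    _ ≤ (Fintype.card ι * ∑ i, w i ^ 4) * ((∫ a, (a ^ 2 - 1) ^ 2 ∂ρ) / Module.finrank ℝ E) :=
        mul_le_mul_of_nonneg_right hw (div_nonneg hv_nonneg (Nat.cast_nonneg _))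
    _ = Fintype.card ι / Module.finrank ℝ E * (∑ i, w i ^ 4) * ∫ a, (a ^ 2 - 1) ^ 2 ∂ρ := by
        ring

lemma integral_sq_norm_sum_smul_sq_sub_le (hσ : IsRotationInvariant σ)
    (hσ_norm : ∀ᵐ u ∂σ, ‖u‖ = 1) (hρ_nonneg : ∀ᵐ a ∂ρ, 0 ≤ a)
    (hρ : MemLp (fun a ↦ a ^ 2) 2 ρ) (hρ_sq : ∫ a, a ^ 2 ∂ρ = 1) (w : ι → ℝ) :
    ∫ z, (‖∑ i, w i • (z i).2‖ ^ 2 - ‖∑ i, w i • (z i).1 • (z i).2‖ ^ 2) ^ 2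
        ∂(Measure.pi fun _ : ι ↦ ρ.prod σ) ≤
      (2 + 8 * Fintype.card ι / Module.finrank ℝ E) * (∑ i, w i ^ 4) *
        ∫ a, (a ^ 2 - 1) ^ 2 ∂ρ := by
  have hmemLp : MemLp id 2 ρ :=
    (memLp_two_iff_integrable_sq (by fun_prop)).2 (hρ.integrable one_le_two)
  have hdiag := (memLp_sum_mul_one_sub_sq (τ := σ) hρ w).integrable_sq
  have hpair := (memLp_sum_innerDefect hσ_norm hmemLp
    fun p : ι × ι ↦ w p.1 * w p.2).integrable_sq
  calc ∫ z, (‖∑ i, w i • (z i).2‖ ^ 2 - ‖∑ i, w i • (z i).1 • (z i).2‖ ^ 2) ^ 2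
        ∂(Measure.pi fun _ : ι ↦ ρ.prod σ)
      ≤ ∫ z : ι → ℝ × E, (2 * (∑ i, w i ^ 2 * (1 - (z i).1 ^ 2)) ^ 2 +
          8 * (∑ p : ι × ι with p.1 < p.2, w p.1 * w p.2 * innerDefect (z p.1) (z p.2)) ^ 2)
          ∂(Measure.pi fun _ ↦ ρ.prod σ) := by
        refine integral_mono_of_nonneg (.of_forall fun z ↦ sq_nonneg _)
          ((hdiag.const_mul 2).add (hpair.const_mul 8)) ?_
        filter_upwards [ae_norm_sum_smul_sq_sub_norm_sum_smul_sq hσ_norm w] with z hz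
        rw [hz]
        nlinarith [sq_nonneg (∑ i, w i ^ 2 * (1 - (z i).1 ^ 2) -
          2 * ∑ p : ι × ι with p.1 < p.2, w p.1 * w p.2 * innerDefect (z p.1) (z p.2))]
    _ ≤ (2 + 8 * Fintype.card ι / Module.finrank ℝ E) * (∑ i, w i ^ 4) *
        ∫ a, (a ^ 2 - 1) ^ 2 ∂ρ := by
        rw [integral_add (hdiag.const_mul 2) (hpair.const_mul 8), integral_const_mul,
          integral_const_mul, integral_sq_sum_mul_one_sub_sq hρ hρ_sq]
        refine (add_le_add_right (mul_le_mul_of_nonneg_left (integral_sq_sum_innerDefect_le hσ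
          hσ_norm hρ_nonneg hρ hρ_sq w) (by norm_num)) _).trans_eq ?_
        ring

lemma norm_charFun_map_norm_sum_smul_sq_sub_le {m : Measure E} [IsProbabilityMeasure m]
    (hσ : IsRotationInvariant σ) (hσ_norm : ∀ᵐ u ∂σ, ‖u‖ = 1) (hm : IsRotationInvariant m)
    (hm_memLp : MemLp (fun x ↦ ‖x‖ ^ 2) 2 m) (hm_sq : ∫ x, ‖x‖ ^ 2 ∂m = 1) (w : ι → ℝ) (t : ℝ) :
    ‖charFun ((Measure.pi fun _ ↦ σ).map fun u ↦ ‖∑ i, w i • u i‖ ^ 2) t -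
        charFun ((Measure.pi fun _ ↦ m).map fun x ↦ ‖∑ i, w i • x i‖ ^ 2) t‖ ≤
      |t| * √((2 + 8 * Fintype.card ι / Module.finrank ℝ E) * (∑ i, w i ^ 4) *
        ∫ x, (‖x‖ ^ 2 - 1) ^ 2 ∂m) := by
  have : IsProbabilityMeasure (m.map norm) := Measure.isProbabilityMeasure_map (by fun_prop)
  have hρ_nonneg : ∀ᵐ a ∂(m.map norm), 0 ≤ a :=
    (ae_map_iff (by fun_prop) measurableSet_Ici).2 (.of_forall norm_nonneg)
  have hρ : MemLp (fun a ↦ a ^ 2) 2 (m.map norm) :=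
    (memLp_map_measure_iff (by fun_prop) (by fun_prop)).2 hm_memLp
  have hρ_sq : ∫ a, a ^ 2 ∂(m.map norm) = 1 := by
    rwa [integral_map (by fun_prop) (by fun_prop)]
  have hmemLp : MemLp id 2 (m.map norm) :=
    (memLp_two_iff_integrable_sq (by fun_prop)).2 (hρ.integrable one_le_two)
  have hdir : MeasurePreserving (fun (z : ι → ℝ × E) i ↦ (z i).2)
      (Measure.pi fun _ ↦ (m.map norm).prod σ) (Measure.pi fun _ ↦ σ) :=
    measurePreserving_pi _ _ fun _ ↦ measurePreserving_snd
  have hpolar : MeasurePreserving (fun (z : ι → ℝ × E) i ↦ (z i).1 • (z i).2)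
      (Measure.pi fun _ ↦ (m.map norm).prod σ) (Measure.pi fun _ ↦ m) :=
    measurePreserving_pi _ _ fun _ ↦ hm.measurePreserving_smul_prod hσ hσ_norm
  have hmeas : Measurable fun x : ι → E ↦ ‖∑ i, w i • x i‖ ^ 2 :=
    Continuous.measurable (by fun_prop)
  rw [← hdir.map_eq, Measure.map_map hmeas hdir.measurable, ← hpolar.map_eq,
    Measure.map_map hmeas hpolar.measurable]
  refine (norm_charFun_map_sub_charFun_map_le (hmeas.comp hdir.measurable).aemeasurable
    (hmeas.comp hpolar.measurable).aemeasurable ?_ t).trans ?_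
  · exact ((memLp_sum_mul_one_sub_sq hρ w).add ((memLp_sum_innerDefect hσ_norm hmemLp
      fun p : ι × ι ↦ w p.1 * w p.2).const_mul 2)).ae_eq
        ((ae_norm_sum_smul_sq_sub_norm_sum_smul_sq hσ_norm w).mono fun z hz ↦ hz.symm)
  · gcongr
    refine (integral_sq_norm_sum_smul_sq_sub_le hσ hσ_norm hρ_nonneg hρ hρ_sq w).trans_eq ?_
    rw [integral_map (by fun_prop) (by fun_prop)]

lemma norm_charFun_map_norm_sum_smul_sq_uniformUnitSphere_sub_le (d : ℕ) [NeZero d] (w : ι → ℝ)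
    (t : ℝ) :
    ‖charFun ((Measure.pi fun _ ↦ uniformUnitSphere d).map fun u ↦ ‖∑ i, w i • u i‖ ^ 2) t -
        charFun ((stdGaussian (EuclideanSpace ℝ (Fin d))).map
          fun x ↦ (∑ i, w i ^ 2) / d * ‖x‖ ^ 2) t‖ ≤
      |t| * √((4 / d) * (1 + 4 * Fintype.card ι / d) * ∑ i, w i ^ 4) := by
  rw [← map_norm_sq_sum_smul_pi_normalizedGaussian]
  refine (norm_charFun_map_norm_sum_smul_sq_sub_le (isRotationInvariant_uniformUnitSphere d)
    (ae_norm_eq_one_uniformUnitSphere d) (isRotationInvariant_normalizedGaussian d)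
    (memLp_norm_sq_normalizedGaussian d) (integral_norm_sq_normalizedGaussian d) w t).trans_eq ?_
  rw [integral_norm_sq_sub_one_sq_normalizedGaussian, finrank_euclideanSpace_fin]
  ring_nf

end RadialFactors

section WalkLaw

variable {ι : Type*} [Fintype ι] {μ : Measure ℝ} [IsProbabilityMeasure μ] (d : ℕ) [NeZero d]

lemma norm_charFun_map_prod_uniformUnitSphere_sub_le [LinearOrder ι]
    (hμ : MemLp (fun r ↦ r ^ 2) 2 μ) (t : ℝ) :
    ‖charFun (((Measure.pi fun _ : ι ↦ μ).prod (Measure.pi fun _ : ι ↦ uniformUnitSphere d)).map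
          fun z ↦ ‖∑ i, z.1 i • z.2 i‖ ^ 2) t -
        charFun (((Measure.pi fun _ : ι ↦ μ).prod (stdGaussian (EuclideanSpace ℝ (Fin d)))).map
          fun z ↦ (∑ i, z.1 i ^ 2) / d * ‖z.2‖ ^ 2) t‖ ≤
      |t| * √((4 / d) * (1 + 4 * Fintype.card ι / d) * (Fintype.card ι * ∫ r, r ^ 4 ∂μ)) := by
  have hint : Integrable (fun r ↦ r ^ 4) μ := by
    simpa only [← pow_mul] using hμ.integrable_sq
  have hint_sum : Integrable (fun r : ι → ℝ ↦ ∑ i, r i ^ 4) (Measure.pi fun _ ↦ μ) :=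
    integrable_finsetSum _ fun i _ ↦
      (measurePreserving_eval (fun _ : ι ↦ μ) i).integrable_comp_of_integrable hint
  let K : ℝ := (4 / d) * (1 + 4 * Fintype.card ι / d)
  have hK : 0 ≤ K := by positivity
  have hsq (r : ι → ℝ) : √(K * ∑ i, r i ^ 4) ^ 2 = K * ∑ i, r i ^ 4 :=
    Real.sq_sqrt (mul_nonneg hK (Finset.sum_nonneg fun i _ ↦ by positivity))
  have hmemLp : MemLp (fun r : ι → ℝ ↦ √(K * ∑ i, r i ^ 4)) 2 (Measure.pi fun _ ↦ μ) := by
    rw [memLp_two_iff_integrable_sq (Continuous.aestronglyMeasurable (by fun_prop))]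
    simpa only [hsq] using hint_sum.const_mul K
  calc _ ≤ ∫ r : ι → ℝ, |t| * √(K * ∑ i, r i ^ 4) ∂(Measure.pi fun _ ↦ μ) :=
        norm_charFun_map_prod_sub_le (Continuous.measurable (by fun_prop))
          (Continuous.measurable (by fun_prop))
          ((hmemLp.integrable one_le_two).const_mul |t|) t fun r ↦
            norm_charFun_map_norm_sum_smul_sq_uniformUnitSphere_sub_le d r t
    _ ≤ |t| * √(∫ r : ι → ℝ, √(K * ∑ i, r i ^ 4) ^ 2 ∂(Measure.pi fun _ ↦ μ)) := by
        rw [integral_const_mul]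
        gcongr
        simpa only [abs_of_nonneg (Real.sqrt_nonneg _)] using
          integral_abs_le_sqrt_integral_sq hmemLp
    _ = |t| * √(K * (Fintype.card ι * ∫ r, r ^ 4 ∂μ)) := by
        simp only [hsq]
        rw [integral_const_mul, integral_sum_comp_eval_pi fun _ ↦ hint]
        simp

omit [NeZero d] in
lemma charFun_map_sum_sq_sub_one_add_norm_sq_sub_prod_stdGaussian (c t : ℝ) :
    charFun (((Measure.pi fun _ : ι ↦ μ).prod (stdGaussian (EuclideanSpace ℝ (Fin d)))).map
        fun z ↦ ∑ i, (z.1 i ^ 2 - 1) + c * (‖z.2‖ ^ 2 - d)) t =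
      charFun (μ.map fun r ↦ r ^ 2 - 1) t ^ Fintype.card ι *
        charFun ((gaussianReal 0 1).map fun x ↦ x ^ 2 - 1) (c * t) ^ d := by
  rw [charFun_map_add_prod (f := fun r : ι → ℝ ↦ ∑ i, (r i ^ 2 - 1))
      (g := fun x : EuclideanSpace ℝ (Fin d) ↦ c * (‖x‖ ^ 2 - d)) (by fun_prop) (by fun_prop),
    charFun_map_mul_comp (by fun_prop), charFun_map_norm_sq_sub_stdGaussian,
    charFun_map_sum_comp_eval_pi (f := fun _ r ↦ r ^ 2 - 1) fun _ ↦ by fun_prop, Finset.prod_const,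
    Finset.card_univ]

lemma norm_charFun_map_prod_stdGaussian_sub_mul_le (hμ : MemLp (fun r ↦ r ^ 2) 2 μ)
    (hμ_sq : ∫ r, r ^ 2 ∂μ = 1) (t : ℝ) :
    ‖charFun (((Measure.pi fun _ : ι ↦ μ).prod (stdGaussian (EuclideanSpace ℝ (Fin d)))).map
          fun z ↦ (∑ i, z.1 i ^ 2) / d * ‖z.2‖ ^ 2 - Fintype.card ι) t -
        charFun (μ.map fun r ↦ r ^ 2 - 1) t ^ Fintype.card ι *
          charFun ((gaussianReal 0 1).map fun x ↦ x ^ 2 - 1) (Fintype.card ι / d * t) ^ d‖ ≤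
      |t| * √(2 / d * (Fintype.card ι * ∫ r, (r ^ 2 - 1) ^ 2 ∂μ)) := by
  have hd : (d : ℝ) ≠ 0 := NeZero.ne _
  have hμ_sub : MemLp (fun r ↦ r ^ 2 - 1) 2 μ := hμ.sub (memLp_const 1)
  have hμ_mean : ∫ r, (r ^ 2 - 1) ∂μ = 0 := by
    rw [integral_sub (hμ.integrable one_le_two) (integrable_const 1), hμ_sq]
    simp
  have hX : MemLp (fun r : ι → ℝ ↦ ∑ i, (r i ^ 2 - 1)) 2 (Measure.pi fun _ ↦ μ) :=
    memLp_finsetSum _ fun i _ ↦ hμ_sub.comp_measurePreserving (measurePreserving_eval _ i)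
  have hY : MemLp (fun x : EuclideanSpace ℝ (Fin d) ↦ (d : ℝ)⁻¹ * (‖x‖ ^ 2 - d)) 2
      (stdGaussian (EuclideanSpace ℝ (Fin d))) :=
    ((memLp_norm_sq_stdGaussian d).sub (memLp_const _)).const_mul _
  have hdefect (z : (ι → ℝ) × EuclideanSpace ℝ (Fin d)) :
      (∑ i, z.1 i ^ 2) / d * ‖z.2‖ ^ 2 - Fintype.card ι -
          (∑ i, (z.1 i ^ 2 - 1) + Fintype.card ι / d * (‖z.2‖ ^ 2 - d)) =
        (∑ i, (z.1 i ^ 2 - 1)) * ((d : ℝ)⁻¹ * (‖z.2‖ ^ 2 - d)) := by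
    simp only [Finset.sum_sub_distrib, Finset.sum_const, Finset.card_univ, nsmul_eq_mul]
    field_simp
    ring
  rw [← charFun_map_sum_sq_sub_one_add_norm_sq_sub_prod_stdGaussian]
  refine (norm_charFun_map_sub_charFun_map_le (Continuous.aemeasurable (by fun_prop))
    (Continuous.aemeasurable (by fun_prop)) ?_ t).trans_eq ?_
  · simpa only [hdefect] using memLp_mul_prod hX hY
  · simp only [hdefect, mul_pow]
    rw [integral_prod_mul (fun r : ι → ℝ ↦ (∑ i, (r i ^ 2 - 1)) ^ 2)
        fun x : EuclideanSpace ℝ (Fin d) ↦ (d : ℝ)⁻¹ ^ 2 * (‖x‖ ^ 2 - d) ^ 2,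
      integral_sq_sum_comp_eval_pi (f := fun _ r ↦ r ^ 2 - 1) (fun _ ↦ hμ_sub) fun _ ↦ hμ_mean,
      integral_const_mul, integral_norm_sq_sub_sq_stdGaussian, Finset.sum_const, Finset.card_univ,
      nsmul_eq_mul]
    congr 2
    field_simp

lemma norm_charFun_map_prod_uniformUnitSphere_sub_mul_le [LinearOrder ι]
    (hμ : MemLp (fun r ↦ r ^ 2) 2 μ) (hμ_sq : ∫ r, r ^ 2 ∂μ = 1) (t : ℝ) :
    ‖charFun (((Measure.pi fun _ : ι ↦ μ).prod (Measure.pi fun _ : ι ↦ uniformUnitSphere d)).map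
          fun z ↦ ‖∑ i, z.1 i • z.2 i‖ ^ 2 - Fintype.card ι) t -
        charFun (μ.map fun r ↦ r ^ 2 - 1) t ^ Fintype.card ι *
          charFun ((gaussianReal 0 1).map fun x ↦ x ^ 2 - 1) (Fintype.card ι / d * t) ^ d‖ ≤
      |t| * √((4 / d) * (1 + 4 * Fintype.card ι / d) * (Fintype.card ι * ∫ r, r ^ 4 ∂μ)) +
        |t| * √(2 / d * (Fintype.card ι * ∫ r, (r ^ 2 - 1) ^ 2 ∂μ)) := by
  refine (norm_sub_le_norm_sub_add_norm_sub _ _ _).trans (add_le_add ?_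
    (norm_charFun_map_prod_stdGaussian_sub_mul_le d hμ hμ_sq t))
  rw [norm_charFun_map_sub_const_sub (Continuous.aemeasurable (by fun_prop))
    (Continuous.aemeasurable (by fun_prop))]
  exact norm_charFun_map_prod_uniformUnitSphere_sub_le d hμ t

end WalkLaw

namespace IsRadialDirectional

variable {Ω₀ Ω : Type*} [MeasurableSpace Ω₀] [MeasurableSpace Ω] {P₀ : Measure Ω₀}
  {P : Measure Ω} {d : ℕ} {R₀ : Ω₀ → ℝ} {R : ℕ → Ω → ℝ} {U : ℕ → Ω → EuclideanSpace ℝ (Fin d)}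

lemma aemeasurable_radialWalk (h : IsRadialDirectional P₀ P d R₀ R U) (n : ℕ) :
    AEMeasurable (radialWalk R U n) P :=
  Finset.aemeasurable_fun_sum _ fun i _ ↦
    (h.radial_copy i).aemeasurable_fst.smul (h.direction_law i).aemeasurable

lemma hasLaw_prodMk [IsProbabilityMeasure P] (h : IsRadialDirectional P₀ P d R₀ R U) (n : ℕ) :
    HasLaw (fun ω ↦ (fun i : Fin n ↦ R i ω, fun i : Fin n ↦ U i ω))
      ((Measure.pi fun _ ↦ P₀.map R₀).prod (Measure.pi fun _ ↦ uniformUnitSphere d)) P := by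
  have hradial (i : ℕ) : HasLaw (R i) (P₀.map R₀) P :=
    ⟨(h.radial_copy i).aemeasurable_fst, (h.radial_copy i).map_eq⟩
  have hindep : IndepFun (fun ω (i : Fin n) ↦ R i ω) (fun ω (i : Fin n) ↦ U i ω) P :=
    h.radial_indep_direction.comp (φ := fun (r : ℕ → ℝ) (i : Fin n) ↦ r i)
      (ψ := fun (u : ℕ → EuclideanSpace ℝ (Fin d)) (i : Fin n) ↦ u i) (by fun_prop) (by fun_prop)
  exact hindep.hasLaw_prod
    ((h.radial_indep.precomp Fin.val_injective).hasLaw_pi fun i ↦ hradial i)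
    ((h.direction_indep.precomp Fin.val_injective).hasLaw_pi fun i ↦ h.direction_law i)

lemma map_norm_sq_radialWalk_sub [IsProbabilityMeasure P]
    (h : IsRadialDirectional P₀ P d R₀ R U) (n : ℕ) :
    P.map (fun ω ↦ ‖radialWalk R U n ω‖ ^ 2 - n) =
      ((Measure.pi fun _ : Fin n ↦ P₀.map R₀).prod
        (Measure.pi fun _ : Fin n ↦ uniformUnitSphere d)).map
          fun z ↦ ‖∑ i, z.1 i • z.2 i‖ ^ 2 - n := by
  rw [← (h.hasLaw_prodMk n).map_eq, AEMeasurable.map_map_of_aemeasurable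
    (Continuous.aemeasurable (by fun_prop)) (h.hasLaw_prodMk n).aemeasurable]
  simp only [radialWalk, Finset.sum_range, Function.comp_def]

lemma norm_charFun_map_norm_sq_radialWalk_sub_le [NeZero d] [IsProbabilityMeasure P₀]
    [IsProbabilityMeasure P] (h : IsRadialDirectional P₀ P d R₀ R U)
    (hR_memLp : MemLp (fun ω ↦ R₀ ω ^ 2) 2 P₀) (hR_two : ∫ ω, R₀ ω ^ 2 ∂P₀ = 1) (n : ℕ) (t : ℝ) :
    ‖charFun (P.map fun ω ↦ ‖radialWalk R U n ω‖ ^ 2 - n) t -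
        charFun (P₀.map fun ω ↦ R₀ ω ^ 2 - 1) t ^ n *
          charFun ((gaussianReal 0 1).map fun x ↦ x ^ 2 - 1) (n / d * t) ^ d‖ ≤
      |t| * √((4 / d) * (1 + 4 * n / d) * (n * ∫ ω, R₀ ω ^ 4 ∂P₀)) +
        |t| * √(2 / d * (n * Var[fun ω ↦ R₀ ω ^ 2; P₀])) := by
  have hR : AEMeasurable R₀ P₀ := (h.radial_copy 0).aemeasurable_snd
  have : IsProbabilityMeasure (P₀.map R₀) := Measure.isProbabilityMeasure_map hR
  have hμ_memLp : MemLp (fun r ↦ r ^ 2) 2 (P₀.map R₀) :=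
    (memLp_map_measure_iff (by fun_prop) hR).2 hR_memLp
  have hμ_sq : ∫ r, r ^ 2 ∂(P₀.map R₀) = 1 := by
    rwa [integral_map hR (by fun_prop)]
  have hbound := norm_charFun_map_prod_uniformUnitSphere_sub_mul_le (ι := Fin n) d hμ_memLp hμ_sq t
  rw [AEMeasurable.map_map_of_aemeasurable (by fun_prop) hR, integral_map hR (by fun_prop),
    integral_map hR (by fun_prop), Fintype.card_fin] at hbound
  rw [h.map_norm_sq_radialWalk_sub n, variance_eq_integral (by fun_prop), hR_two]
  exact hbound

end IsRadialDirectional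

section Limit

variable {ι : Type*} {l : Filter ι} {d n : ι → ℕ} {c : ι → ℝ}

lemma tendsto_abs_mul_sqrt_of_tendsto_sq_mul {A : ι → ℝ} (t : ℝ)
    (h : Tendsto (fun i ↦ c i ^ 2 * A i) l (𝓝 0)) :
    Tendsto (fun i ↦ |c i * t| * √(A i)) l (𝓝 0) := by
  have hsqrt : Tendsto (fun i ↦ |t| * √(c i ^ 2 * A i)) l (𝓝 0) := by
    simpa using h.sqrt.const_mul |t|
  refine hsqrt.congr fun i ↦ ?_
  rw [Real.sqrt_mul (sq_nonneg _), Real.sqrt_sq_eq_abs, abs_mul]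
  ring

lemma tendsto_coupling_error (hd : Tendsto d l atTop) (hn : Tendsto n l atTop)
    (hc : (fun i ↦ c i ^ 2 * (n i ^ 2 / d i)) =O[l] fun _ ↦ (1 : ℝ)) (m V t : ℝ) :
    Tendsto (fun i ↦ |c i * t| * √((4 / d i) * (1 + 4 * n i / d i) * (n i * m)) +
      |c i * t| * √(2 / d i * (n i * V))) l (𝓝 0) := by
  have hinv {k : ι → ℕ} (hk : Tendsto k l atTop) :
      Tendsto (fun i ↦ c i ^ 2 * (n i ^ 2 / d i) * (k i : ℝ)⁻¹) l (𝓝 0) :=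
    (hc.mul (isBigO_refl _ l)).trans_tendsto (by
      simpa [Function.comp_def] using
        tendsto_inv_atTop_zero.comp (tendsto_natCast_atTop_atTop.comp hk))
  have hlin : Tendsto (fun i ↦ c i ^ 2 * (n i / d i)) l (𝓝 0) := by
    refine (hinv hn).congr' ?_
    filter_upwards [hn.eventually_ne_atTop 0] with i hi
    field_simp
  have hquad : Tendsto (fun i ↦ c i ^ 2 * (n i ^ 2 / d i ^ 2)) l (𝓝 0) :=
    (hinv hd).congr fun i ↦ by ring
  rw [← add_zero (0 : ℝ)]
  refine (tendsto_abs_mul_sqrt_of_tendsto_sq_mul t ?_).add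
    (tendsto_abs_mul_sqrt_of_tendsto_sq_mul t ?_)
  · have hsum := (hlin.const_mul (4 * m)).add (hquad.const_mul (16 * m))
    rw [mul_zero, mul_zero, add_zero] at hsum
    exact hsum.congr fun i ↦ by ring
  · have hmul := hlin.const_mul (2 * V)
    rw [mul_zero] at hmul
    exact hmul.congr fun i ↦ by ring

lemma tendsto_sqrt_inv_sq_mul_of_tendsto_div {V γ : ℝ} (hd : Tendsto d l atTop)
    (hn : Tendsto n l atTop) (hγ : Tendsto (fun i ↦ (n i : ℝ) / d i) l (𝓝 γ)) :
    Tendsto (fun i ↦ (√(n i))⁻¹ ^ 2 * (n i * V + 2 * n i ^ 2 / d i)) l (𝓝 (2 * γ + V)) := by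
  refine ((hγ.const_mul 2).add_const V).congr' ?_
  filter_upwards [hd.eventually_ne_atTop 0, hn.eventually_ne_atTop 0] with i hdi hni
  rw [inv_pow, Real.sq_sqrt (by positivity)]
  field_simp
  ring

lemma tendsto_sqrt_two_mul_sq_div_inv_sq_mul {V : ℝ} (hd : Tendsto d l atTop)
    (hn : Tendsto n l atTop) (h : Tendsto (fun i ↦ (n i : ℝ) / d i) l atTop ∨ V = 0) :
    Tendsto (fun i ↦ (√(2 * n i ^ 2 / d i))⁻¹ ^ 2 * (n i * V + 2 * n i ^ 2 / d i)) l (𝓝 1) := by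
  have hradial : Tendsto (fun i ↦ V / 2 * ((n i : ℝ) / d i)⁻¹) l (𝓝 0) := by
    rcases h with hratio | rfl
    · simpa [Function.comp_def] using (tendsto_inv_atTop_zero.comp hratio).const_mul (V / 2)
    · simpa using tendsto_const_nhds
  have hsum := hradial.add_const 1
  rw [zero_add] at hsum
  refine hsum.congr' ?_
  filter_upwards [hd.eventually_ne_atTop 0, hn.eventually_ne_atTop 0] with i hdi hni
  rw [inv_pow, Real.sq_sqrt (by positivity)]
  field_simp

variable {Ω₀ : Type*} [MeasurableSpace Ω₀] {P₀ : Measure Ω₀} [IsProbabilityMeasure P₀]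
  {R₀ : Ω₀ → ℝ}

lemma tendsto_charFun_sq_sub_one_pow_mul_charFun_sq_sub_one_pow
    (hR_memLp : MemLp (fun ω ↦ R₀ ω ^ 2) 2 P₀) (hR_two : ∫ ω, R₀ ω ^ 2 ∂P₀ = 1)
    (hd : Tendsto d l atTop) (hn : Tendsto n l atTop) {v : ℝ}
    (hv : Tendsto (fun i ↦ c i ^ 2 * (n i * Var[fun ω ↦ R₀ ω ^ 2; P₀] + 2 * n i ^ 2 / d i)) l
      (𝓝 v)) (t : ℝ) :
    Tendsto (fun i ↦ charFun (P₀.map fun ω ↦ R₀ ω ^ 2 - 1) (c i * t) ^ n i *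
        charFun ((gaussianReal 0 1).map fun x ↦ x ^ 2 - 1) (n i / d i * (c i * t)) ^ d i) l
      (𝓝 (Complex.exp (-(t ^ 2 * v) / 2 : ℝ))) := by
  have hR_sub : MemLp (fun ω ↦ R₀ ω ^ 2 - 1) 2 P₀ := hR_memLp.sub (memLp_const 1)
  have : IsProbabilityMeasure (P₀.map fun ω ↦ R₀ ω ^ 2 - 1) :=
    Measure.isProbabilityMeasure_map hR_sub.aemeasurable
  have : IsProbabilityMeasure ((gaussianReal 0 1).map fun x ↦ x ^ 2 - 1) :=
    Measure.isProbabilityMeasure_map (by fun_prop)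
  refine tendsto_charFun_pow_mul_charFun_pow
    ((memLp_map_measure_iff (by fun_prop) hR_sub.aemeasurable).2 hR_sub)
    ((memLp_map_measure_iff (by fun_prop) (by fun_prop)).2 memLp_sq_sub_one_gaussianReal)
    ?_ ?_ hn hd ?_
  · rw [integral_map hR_sub.aemeasurable (by fun_prop),
      integral_sub (hR_memLp.integrable one_le_two) (integrable_const 1), hR_two]
    simp
  · rw [integral_map (by fun_prop) (by fun_prop), integral_sq_sub_one_gaussianReal]
  · rw [variance_id_map hR_sub.aemeasurable, variance_sub_const hR_memLp.aestronglyMeasurable,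
      variance_id_map (by fun_prop),
      variance_of_integral_eq_zero (by fun_prop) integral_sq_sub_one_gaussianReal,
      integral_sq_sub_one_sq_gaussianReal]
    refine (hv.const_mul (t ^ 2)).congr' ?_
    filter_upwards [hd.eventually_ne_atTop 0] with i hi
    field_simp

variable [l.IsCountablyGenerated] {Ω : ι → Type*} [∀ i, MeasurableSpace (Ω i)]
  {P : (i : ι) → Measure (Ω i)} [∀ i, IsProbabilityMeasure (P i)] {R : (i : ι) → ℕ → Ω i → ℝ}
  {U : (i : ι) → ℕ → Ω i → EuclideanSpace ℝ (Fin (d i))}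

lemma tendstoInDistribution_mul_norm_sq_radialWalk_sub
    (hR_memLp : MemLp (fun ω ↦ R₀ ω ^ 2) 2 P₀) (hR_two : ∫ ω, R₀ ω ^ 2 ∂P₀ = 1)
    (hRU : ∀ i, IsRadialDirectional P₀ (P i) (d i) R₀ (R i) (U i))
    (hd : Tendsto d l atTop) (hn : Tendsto n l atTop) {v : ℝ≥0}
    (hv : Tendsto (fun i ↦ c i ^ 2 * (n i * Var[fun ω ↦ R₀ ω ^ 2; P₀] + 2 * n i ^ 2 / d i)) l
      (𝓝 (v : ℝ))) :
    TendstoInDistribution (fun i ω ↦ c i * (‖radialWalk (R i) (U i) (n i) ω‖ ^ 2 - n i)) l id P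
      (gaussianReal 0 v) := by
  have hnorm (i : ι) : AEMeasurable (fun ω ↦ ‖radialWalk (R i) (U i) (n i) ω‖ ^ 2 - n i) (P i) :=
    (((hRU i).aemeasurable_radialWalk (n i)).norm.pow_const 2).sub_const _
  have hbounded : (fun i ↦ c i ^ 2 * (n i ^ 2 / d i)) =O[l] fun _ ↦ (1 : ℝ) := by
    refine (IsBigO.of_norm_le fun i ↦ ?_).trans (hv.isBigO_one ℝ)
    have hV := variance_nonneg (fun ω ↦ R₀ ω ^ 2) P₀
    rw [Real.norm_of_nonneg (by positivity)]
    gcongr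
    have hquad : 0 ≤ (n i : ℝ) ^ 2 / d i := by positivity
    rw [mul_div_assoc]
    linarith [mul_nonneg (n i).cast_nonneg hV]
  refine tendstoInDistribution_of_tendsto_charFun (fun i ↦ (hnorm i).const_mul (c i)) fun t ↦ ?_
  have herror : Tendsto (fun i ↦ charFun ((P i).map fun ω ↦
        c i * (‖radialWalk (R i) (U i) (n i) ω‖ ^ 2 - n i)) t -
      charFun (P₀.map fun ω ↦ R₀ ω ^ 2 - 1) (c i * t) ^ n i *
        charFun ((gaussianReal 0 1).map fun x ↦ x ^ 2 - 1) (n i / d i * (c i * t)) ^ d i)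
      l (𝓝 0) := by
    refine squeeze_zero_norm' ?_ (tendsto_coupling_error hd hn hbounded (∫ ω, R₀ ω ^ 4 ∂P₀)
      Var[fun ω ↦ R₀ ω ^ 2; P₀] t)
    filter_upwards [hd.eventually_ne_atTop 0] with i hi
    have : NeZero (d i) := ⟨hi⟩
    rw [charFun_map_mul_comp (hnorm i)]
    exact (hRU i).norm_charFun_map_norm_sq_radialWalk_sub_le hR_memLp hR_two (n i) (c i * t)
  have hlimit := herror.add
    (tendsto_charFun_sq_sub_one_pow_mul_charFun_sq_sub_one_pow hR_memLp hR_two hd hn hv t)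
  have hgaussian : charFun (gaussianReal 0 v) t = Complex.exp (-(t ^ 2 * v) / 2 : ℝ) := by
    rw [charFun_gaussianReal]
    push_cast
    ring_nf
  simpa [hgaussian] using hlimit

end Limit

lemma variance_sq_eq_zero_of_isAlmostSurelyConst {Ω : Type*} [MeasurableSpace Ω] {X : Ω → ℝ}
    {P : Measure Ω} [IsProbabilityMeasure P] (h : IsAlmostSurelyConst X P) :
    Var[fun ω ↦ X ω ^ 2; P] = 0 := by
  obtain ⟨c, hc⟩ := h
  rw [variance_congr (Y := fun _ ↦ c ^ 2) (hc.mono fun ω hω ↦ by simp [hω]),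
    variance_eq_integral (by fun_prop)]
  simp

lemma tendsto_div_of_isEquivalent_const_mul {ι : Type*} {l : Filter ι} {u v : ι → ℝ} {γ : ℝ}
    (h : u ~[l] fun i ↦ γ * v i) (hv : ∀ᶠ i in l, v i ≠ 0) :
    Tendsto (fun i ↦ u i / v i) l (𝓝 γ) := by
  have hγ : Tendsto (fun i ↦ γ * v i / v i) l (𝓝 γ) :=
    tendsto_const_nhds.congr' (hv.mono fun i hi ↦ by field_simp)
  exact (h.div IsEquivalent.refl).symm.tendsto_nhds hγ

theorem mainTheorem9_general {Ω₀ : Type*} [MeasurableSpace Ω₀] {P₀ : Measure Ω₀}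
    [IsProbabilityMeasure P₀] {R₀ : Ω₀ → ℝ} (hR_two : ∫ ω, R₀ ω ^ 2 ∂P₀ = 1)
    (hR_memLp : MemLp (fun ω ↦ R₀ ω ^ 2) 2 P₀) {ι : Type*} {l : Filter ι} [l.IsCountablyGenerated]
    {Ω : ι → Type*} [∀ i, MeasurableSpace (Ω i)] {P : (i : ι) → Measure (Ω i)}
    [∀ i, IsProbabilityMeasure (P i)] {d n : ι → ℕ} {R : (i : ι) → ℕ → Ω i → ℝ}
    {U : (i : ι) → ℕ → Ω i → EuclideanSpace ℝ (Fin (d i))}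
    (hRU : ∀ i, IsRadialDirectional P₀ (P i) (d i) R₀ (R i) (U i))
    (hd : Tendsto d l atTop) (hn : Tendsto n l atTop) :
    (∀ γ : ℝ, 0 ≤ γ → Tendsto (fun i ↦ (n i : ℝ) / d i) l (𝓝 γ) →
      TendstoInDistribution
        (fun i ω ↦ (‖radialWalk (R i) (U i) (n i) ω‖ ^ 2 - n i) / √(n i))
        l id P (gaussianReal 0 (2 * γ + Var[fun ω ↦ R₀ ω ^ 2; P₀]).toNNReal)) ∧
    (Tendsto (fun i ↦ (n i : ℝ) / d i) l atTop ∨ Var[fun ω ↦ R₀ ω ^ 2; P₀] = 0 →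
      TendstoInDistribution
        (fun i ω ↦ (‖radialWalk (R i) (U i) (n i) ω‖ ^ 2 - n i) / √(2 * n i ^ 2 / d i))
        l id P (gaussianReal 0 1)) := by
  simp only [div_eq_inv_mul _ √_]
  refine ⟨fun γ hγ hratio ↦ ?_, fun h ↦ ?_⟩ <;>
    refine tendstoInDistribution_mul_norm_sq_radialWalk_sub hR_memLp hR_two hRU hd hn ?_
  · rw [Real.coe_toNNReal _ (add_nonneg (by positivity) (variance_nonneg _ _))]
    exact tendsto_sqrt_inv_sq_mul_of_tendsto_div hd hn hratio
  · exact tendsto_sqrt_two_mul_sq_div_inv_sq_mul hd hn h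

theorem mainTheorem9
    {Ω₀ : Type*} [MeasurableSpace Ω₀] (P₀ : Measure Ω₀) [IsProbabilityMeasure P₀]
    (R₀ : Ω₀ → ℝ) (hR_nonneg : ∀ᵐ ω ∂P₀, 0 ≤ R₀ ω)
    (hR_two : ∫ ω, R₀ ω ^ 2 ∂P₀ = 1) (hR_four : Integrable (fun ω ↦ R₀ ω ^ 4) P₀)
    {Ω : ℕ+ → Type*} [∀ d, MeasurableSpace (Ω d)]
    (P : (d : ℕ+) → Measure (Ω d)) [∀ d, IsProbabilityMeasure (P d)]
    (R : (d : ℕ+) → ℕ → Ω d → ℝ)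
    (U : (d : ℕ+) → ℕ → Ω d → EuclideanSpace ℝ (Fin (d : ℕ)))
    (hRU : ∀ d : ℕ+, IsRadialDirectional P₀ (P d) (d : ℕ) R₀ (R d) (U d))
    (n : ℕ+ → ℕ) (hn_pos : ∀ d, 0 < n d) (hn : Tendsto n atTop atTop) :
    (Tendsto (fun d : ℕ+ ↦ (n d : ℝ) / ((d : ℕ) : ℝ)) atTop (𝓝 0) → ¬ IsAlmostSurelyConst R₀ P₀ →
      TendstoInDistribution
        (fun (d : ℕ+) (ω : Ω d) ↦
          (‖radialWalk (R d) (U d) (n d) ω‖ ^ 2 - (n d : ℝ)) / √(n d : ℝ))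
        atTop id P (gaussianReal 0 (Var[fun ω ↦ R₀ ω ^ 2; P₀]).toNNReal)) ∧
    (Tendsto (fun d : ℕ+ ↦ (n d : ℝ) / ((d : ℕ) : ℝ)) atTop atTop ∨ IsAlmostSurelyConst R₀ P₀ →
      TendstoInDistribution
        (fun (d : ℕ+) (ω : Ω d) ↦
          (‖radialWalk (R d) (U d) (n d) ω‖ ^ 2 - (n d : ℝ)) /
            √(2 * (n d : ℝ) ^ 2 / ((d : ℕ) : ℝ)))
        atTop id P (gaussianReal 0 1)) ∧
    (∀ γ : ℝ, 0 < γ →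
      (fun d : ℕ+ ↦ (n d : ℝ)) ~[atTop] (fun d : ℕ+ ↦ γ * ((d : ℕ) : ℝ)) →
      TendstoInDistribution
        (fun (d : ℕ+) (ω : Ω d) ↦
          (‖radialWalk (R d) (U d) (n d) ω‖ ^ 2 - (n d : ℝ)) / √(n d : ℝ))
        atTop id P (gaussianReal 0 (2 * γ + Var[fun ω ↦ R₀ ω ^ 2; P₀]).toNNReal)) := by
  have hR_memLp : MemLp (fun ω ↦ R₀ ω ^ 2) 2 P₀ :=
    (memLp_two_iff_integrable_sq
      (((hRU 1).radial_copy 0).aemeasurable_snd.pow_const 2).aestronglyMeasurable).2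
      (by simpa only [← pow_mul] using hR_four)
  have hgeneral := mainTheorem9_general hR_two hR_memLp hRU tendsto_PNat_val_atTop_atTop hn
  refine ⟨fun hratio _ ↦ by simpa using hgeneral.1 0 le_rfl hratio,
    fun h ↦ hgeneral.2 (h.imp_right variance_sq_eq_zero_of_isAlmostSurelyConst),
    fun γ hγ h ↦ hgeneral.1 γ hγ.le (tendsto_div_of_isEquivalent_const_mul h ?_)⟩
  exact .of_forall fun d ↦ Nat.cast_ne_zero.2 d.ne_zero
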